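/- A tournament is an orientation of a complete graph, and an oriented tree is an orientation of a (finite, undirected) tree, where an orientation of a simple graph is obtained by replacing each edge by exactly one of its two possible arcs. For a non-negative integer $m$, a digraph $D$ is called $m$-unavoidable if every tournament of order $m$ contains $D$ as a (not necessarily induced) subdigraph, up to isomorphism; for a non-negative real number $x$, $D$ is called $x$-unavoidable if it is $\lceil x\rceil$-unavoidable. Corollary. For every integer $n \ge 2$, every oriented tree of order $n$ is $\left(\frac{21}{8}n - \frac{47}{16}\right)$-unavoidable; that is, it is contained in every tournament of order $\left\lceil \frac{21}{8}n - \frac{47}{16}\right\rceil$. -/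

import Mathlib

universe u v

namespace Digraph

/-- `D` is an orientation of the simple graph `G`: every edge of `G` carries exactly one of its two
possible arcs, and `D` has no other arcs (in particular no loops). -/
def IsOrientationOf {V : Type u} (D : Digraph V) (G : SimpleGraph V) : Prop :=
  (∀ x y, G.Adj x y ↔ D.Adj x y ∨ D.Adj y x) ∧ ∀ x y, D.Adj x y → ¬ D.Adj y x

/-- A tournament is an orientation of a complete graph. -/
def IsTournament {V : Type u} (D : Digraph V) : Prop :=
  D.IsOrientationOf (⊤ : SimpleGraph V)

/-- An oriented tree is an orientation of a tree. -/
def IsOrientedTree {V : Type u} (D : Digraph V) : Prop :=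
  ∃ G : SimpleGraph V, G.IsTree ∧ D.IsOrientationOf G

/-- `D` is contained in `T` (up to isomorphism) as a subdigraph, not necessarily induced. -/
def IsContainedIn {V : Type u} {W : Type v} (D : Digraph V) (T : Digraph W) : Prop :=
  ∃ f : V → W, Function.Injective f ∧ ∀ x y, D.Adj x y → T.Adj (f x) (f y)

/-- `D` is `m`-unavoidable: it is contained in every tournament of order `m`. -/
def IsUnavoidable {V : Type u} (D : Digraph V) (m : ℕ) : Prop :=
  ∀ (W : Type v) [Fintype W], Fintype.card W = m →
    ∀ T : Digraph W, T.IsTournament → D.IsContainedIn T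

end Digraph

/-!
The proof works with *rooted* oriented trees (`RootedTree`). Let `A` be one with `n` vertices, `k`
of which are childless. All bounds rest on median orders of a tournament (`exists_median_order`):
every vertex dominates at least half of each interval right after it, and is dominated by at least
half of each interval right before it.

*Few childless vertices.* If all arcs lead away from the root, then `A` is embedded greedily: the
positions of a median order are treated from left to right, and the vertex placed at a position
reserves its first free out-neighbours for its children. In general, the deletion of the arcs
leading away from the root leaves *blocks*, which are arborescences with all arcs reversed; a
vertex then reserves, for each block attached to it, enough positions to embed the whole block by
the first case. The procedure does not get stuck (`RootedTree.EmbeddingState.lt_of_stuck`),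
because the positions missed so far are at most as many as the reserved positions that have
reserved nothing in their turn (`IsGreedy.card_missed_le`). Applied to `A` and to its reverse,
this gives two bounds with average about `3 (n + k) / 2`
(`RootedTree.unavoidable_of_card_add_childless`).

*Many childless vertices.* The *inner tree*, formed by the `x = n - k` vertices of `A` that
have children, is embedded into a window in the middle of a median order by the first bound, and
the childless vertices are added by Hall's theorem: those entered by an arc go to the right of
their parents, the others to the left of them. If the right neighbourhood of a position `p` meets
the left neighbourhood of a position `q`, then `p < q`, and the overlap between them is
compensated by the *star centres* between them, the inner vertices with only childless children:
each has a childless child that does not belong to the set for which Hall's condition is being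
verified. The resulting bound is `2 k + 2 x + c - z` (`RootedTree.unavoidable_of_inner`), where
`z` is the number of star centres and `c` is the bound for the inner tree, which has exactly the
star centres as its childless vertices.

The first bound suffices if `k ≤ 3 x - 3`, and the second one if `k ≥ 3 x - 2`, up to the case
`x = 1`, `k ≤ 3`, where the first one does (`RootedTree.unavoidable_of_card`).
-/

namespace OrientedTrees

open Finset
open scoped Classical

/-! ### Median orders -/

/-- The relation `E` restricted to the finite set `S` is a tournament. Nothing is required of the
diagonal, so loops are irrelevant. -/
def IsTournamentOn (E : ℕ → ℕ → Prop) (S : Finset ℕ) : Prop :=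
  ∀ x ∈ S, ∀ y ∈ S, x ≠ y → (E x y ↔ ¬ E y x)

/-- The number of pairs of entries of a list that are joined by a forward arc. -/
noncomputable def forwardArcs (E : ℕ → ℕ → Prop) : List ℕ → ℕ
  | [] => 0
  | a :: l => l.countP (fun w => E a w) + forwardArcs E l

/-- The number of arcs from the entries of one list to the entries of another. -/
noncomputable def crossArcs (E : ℕ → ℕ → Prop) (l l' : List ℕ) : ℕ :=
  (l.map fun a => l'.countP (fun w => E a w)).sum

lemma forwardArcs_append (E : ℕ → ℕ → Prop) (l l' : List ℕ) :
    forwardArcs E (l ++ l') = forwardArcs E l + forwardArcs E l' + crossArcs E l l' := by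
  induction l with
  | nil => simp [forwardArcs, crossArcs]
  | cons a l ih =>
    simp only [List.cons_append, forwardArcs, ih, List.countP_append, crossArcs, List.map_cons,
      List.sum_cons]
    omega

lemma crossArcs_append_right (E : ℕ → ℕ → Prop) (l l₁ l₂ : List ℕ) :
    crossArcs E l (l₁ ++ l₂) = crossArcs E l l₁ + crossArcs E l l₂ := by
  simp [crossArcs, List.countP_append, List.sum_map_add]

lemma crossArcs_append_left (E : ℕ → ℕ → Prop) (l₁ l₂ l : List ℕ) :
    crossArcs E (l₁ ++ l₂) l = crossArcs E l₁ l + crossArcs E l₂ l := by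
  simp [crossArcs]

lemma crossArcs_singleton_left (E : ℕ → ℕ → Prop) (a : ℕ) (l : List ℕ) :
    crossArcs E [a] l = l.countP (fun w => E a w) := by
  simp [crossArcs]

lemma crossArcs_singleton_right (E : ℕ → ℕ → Prop) (a : ℕ) (l : List ℕ) :
    crossArcs E l [a] = l.countP (fun w => E w a) := by
  induction l with
  | nil => simp [crossArcs]
  | cons b l ih =>
    rw [show crossArcs E (b :: l) [a] = [a].countP (fun w => E b w) + crossArcs E l [a] by
      simp [crossArcs], ih, List.countP_cons, List.countP_cons, List.countP_nil]
    omega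

/-- The effect on the number of forward arcs of moving one entry across an interval. -/
lemma forwardArcs_move (E : ℕ → ℕ → Prop) (a : ℕ) (l₁ l₂ l₃ : List ℕ) :
    forwardArcs E (l₁ ++ ([a] ++ l₂) ++ l₃) + l₂.countP (fun w => E w a) =
      forwardArcs E (l₁ ++ (l₂ ++ [a]) ++ l₃) + l₂.countP (fun w => E a w) := by
  simp only [forwardArcs_append, crossArcs_append_left, crossArcs_append_right,
    crossArcs_singleton_left, crossArcs_singleton_right]
  omega

lemma countP_take_drop_eq_card (P : ℕ → Prop) (l : List ℕ) (i k : ℕ) (h : i + k ≤ l.length) :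
    ((l.drop i).take k).countP (fun w => P w) = #{w ∈ Ico i (i + k) | P (l.getD w 0)} := by
  induction k with
  | zero => simp
  | succ k ih =>
    have hlt : k < (l.drop i).length := by simp; omega
    rw [List.take_succ_eq_append_getElem hlt, List.countP_append, ih (by omega), ← add_assoc,
      ← Finset.insert_Ico_right_eq_Ico_add_one (by omega), filter_insert]
    have hik : i + k < l.length := by omega
    have hget : l.getD (i + k) 0 = l[i + k] := by simp [List.getD_eq_getElem?_getD, hik]
    rw [hget]
    split_ifs with hp
    · rw [card_insert_of_notMem (by simp)]; simp [hp]
    · simp [hp]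

/-- Every finite tournament has a median order: an enumeration in which each vertex dominates at
least half of every interval starting right after it, and is dominated by at least half of every
interval ending right before it. It is obtained by maximising the number of forward arcs. -/
theorem exists_median_order (E : ℕ → ℕ → Prop) (S : Finset ℕ) (hS : IsTournamentOn E S) :
    ∃ e : ℕ → ℕ, Set.InjOn e (Set.Iio S.card) ∧ (∀ i < S.card, e i ∈ S) ∧
      (∀ r j, r < j → j ≤ S.card →
        #{w ∈ Ico (r + 1) j | ¬ E (e r) (e w)} ≤ #{w ∈ Ico (r + 1) j | E (e r) (e w)}) ∧
      (∀ i j, i ≤ j → j < S.card →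
        #{w ∈ Ico i j | ¬ E (e w) (e j)} ≤ #{w ∈ Ico i j | E (e w) (e j)}) := by
  obtain ⟨l, hl, hmax⟩ := Finset.exists_max_image S.toList.permutations.toFinset (forwardArcs E)
    ⟨S.toList, by simp⟩
  have hp : l.Perm S.toList := by simpa using hl
  have hlen : l.length = S.card := by simpa using hp.length_eq
  have hmem : ∀ w ∈ l, w ∈ S := fun w hw => by simpa using hp.mem_iff.1 hw
  have hnd : l.Nodup := hp.nodup_iff.2 S.nodup_toList
  have hget : ∀ i (hi : i < l.length), l.getD i 0 = l[i] := fun i hi => by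
    simp [List.getD_eq_getElem?_getD, hi]
  have hmax' : ∀ l' : List ℕ, l'.Perm l → forwardArcs E l' ≤ forwardArcs E l := fun l' h' =>
    hmax l' (by simpa using h'.trans hp)
  have heS : ∀ i < S.card, l.getD i 0 ∈ S := fun i hi => by
    rw [hget i (by omega)]; exact hmem _ (List.getElem_mem _)
  have hinj : Set.InjOn (fun i => l.getD i 0) (Set.Iio S.card) := by
    intro i hi j hj hij
    simp only [Set.mem_Iio] at hi hj
    simp only [hget i (by omega), hget j (by omega)] at hij
    exact (hnd.getElem_inj_iff).1 hij
  refine ⟨fun i => l.getD i 0, hinj, heS, ?_, ?_⟩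
  · intro r j hrj hj
    have hr : r < l.length := by omega
    set l₂ := (l.drop (r + 1)).take (j - (r + 1)) with hl₂
    have hsplit : l = l.take r ++ ([l[r]] ++ l₂) ++ (l.drop (r + 1)).drop (j - (r + 1)) := by
      have h1 := List.take_append_drop (j - (r + 1)) (l.drop (r + 1))
      rw [List.append_assoc, List.append_assoc, hl₂, h1, List.singleton_append,
        ← List.drop_eq_getElem_cons hr, List.take_append_drop]
    have hmove := forwardArcs_move E l[r] (l.take r) l₂ ((l.drop (r + 1)).drop (j - (r + 1)))
    rw [← hsplit] at hmove
    have hle := hmax' (l.take r ++ (l₂ ++ [l[r]]) ++ (l.drop (r + 1)).drop (j - (r + 1))) (by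
      conv_rhs => rw [hsplit]
      exact ((List.perm_append_comm).append_left _).append_right _)
    have hc1 := countP_take_drop_eq_card (fun w => E w l[r]) l (r + 1) (j - (r + 1)) (by omega)
    have hc2 := countP_take_drop_eq_card (fun w => E l[r] w) l (r + 1) (j - (r + 1)) (by omega)
    have hj' : r + 1 + (j - (r + 1)) = j := by omega
    rw [hj', ← hl₂] at hc1 hc2
    rw [hc1, hc2] at hmove
    have heq : #{w ∈ Ico (r + 1) j | ¬ E (l.getD r 0) (l.getD w 0)} =
        #{w ∈ Ico (r + 1) j | E (l.getD w 0) l[r]} := by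
      congr 1
      refine filter_congr fun w hw => ?_
      rw [mem_Ico] at hw
      rw [← hget r hr]
      refine (hS _ (heS w (by omega)) _ (heS r (by omega)) fun h => ?_).symm
      have := hinj (Set.mem_Iio.2 (by omega)) (Set.mem_Iio.2 (by omega)) h
      omega
    simp only [hget r hr] at heq ⊢
    omega
  · intro i j hij hj
    have hjl : j < l.length := by omega
    set l₂ := (l.drop i).take (j - i) with hl₂
    have hsplit : l = l.take i ++ (l₂ ++ [l[j]]) ++ l.drop (j + 1) := by
      have h1 := List.take_append_drop (j - i) (l.drop i)
      rw [List.drop_drop, show i + (j - i) = j by omega, List.drop_eq_getElem_cons hjl] at h1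
      rw [List.append_assoc, List.append_assoc, hl₂, List.singleton_append, h1,
        List.take_append_drop]
    have hmove := forwardArcs_move E l[j] (l.take i) l₂ (l.drop (j + 1))
    rw [← hsplit] at hmove
    have hle := hmax' (l.take i ++ ([l[j]] ++ l₂) ++ l.drop (j + 1)) (by
      conv_rhs => rw [hsplit]
      exact ((List.perm_append_comm).append_left _).append_right _)
    have hc1 := countP_take_drop_eq_card (fun w => E w l[j]) l i (j - i) (by omega)
    have hc2 := countP_take_drop_eq_card (fun w => E l[j] w) l i (j - i) (by omega)
    have hj' : i + (j - i) = j := by omega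
    rw [hj', ← hl₂] at hc1 hc2
    rw [hc1, hc2] at hmove
    have heq : #{w ∈ Ico i j | ¬ E (l.getD w 0) (l.getD j 0)} =
        #{w ∈ Ico i j | E l[j] (l.getD w 0)} := by
      congr 1
      refine filter_congr fun w hw => ?_
      rw [mem_Ico] at hw
      rw [← hget j hjl]
      refine (hS _ (heS j (by omega)) _ (heS w (by omega)) fun h => ?_).symm
      have := hinj (Set.mem_Iio.2 (by omega)) (Set.mem_Iio.2 (by omega)) h
      omega
    simp only [hget j hjl] at heq ⊢
    omega

/-! ### Greedy sets of positions -/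

/-- The elements of `H` that are the `p`-parent of no non-zero element of `H`. -/
noncomputable def childless (H : Finset ℕ) (p : ℕ → ℕ) : Finset ℕ :=
  {h ∈ H | ∀ h' ∈ H, h' ≠ 0 → p h' ≠ h}

/-- A set `H` of positions with a parent function `p` is *greedy* for `E` if each position comes
after its parent, and every position between `p h` and `h` that is dominated by `p h` belongs to
`H` and has a parent that is not after `p h`. -/
structure IsGreedy (E : ℕ → ℕ → Prop) (H : Finset ℕ) (p : ℕ → ℕ) : Prop where
  zero_mem : 0 ∈ H
  par_mem : ∀ h ∈ H, h ≠ 0 → p h ∈ H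
  par_lt : ∀ h ∈ H, h ≠ 0 → p h < h
  between : ∀ h ∈ H, h ≠ 0 → ∀ w, p h < w → w < h → E (p h) w → w ∈ H ∧ p w ≤ p h

/-- If no position after `i` has its parent strictly between `r` and `i`, then the elements of `H`
between `r` and `i` whose parent is not after `r` are the roots of a forest on all the elements
between `r` and `i`, so they are at most as many as the childless elements there. -/
lemma card_filter_between_le_card_childless {H : Finset ℕ} {p : ℕ → ℕ} {r i : ℕ}
    (hlt : ∀ h ∈ H, h ≠ 0 → p h < h) (hi : i ∉ H)
    (hact : ∀ h ∈ H, i < h → p h ≤ r ∨ i ≤ p h) :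
    #{w ∈ H | (r < w ∧ w < i) ∧ p w ≤ r} ≤ #{w ∈ childless H p | r < w ∧ w < i} := by
  set B := {w ∈ H | r < w ∧ w < i} with hB
  have h1 : #B = #{w ∈ B | p w ≤ r} + #{w ∈ B | ¬ p w ≤ r} :=
    (card_filter_add_card_filter_not _).symm
  have h2 : #B = #{w ∈ B | w ∈ childless H p} + #{w ∈ B | w ∉ childless H p} :=
    (card_filter_add_card_filter_not _).symm
  -- Every element with a child has a child inside the interval, so `p` is onto these elements.
  have h3 : #{w ∈ B | w ∉ childless H p} ≤ #{w ∈ B | ¬ p w ≤ r} := by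
    refine card_le_card_of_surjOn p fun w hw => ?_
    simp only [coe_filter, Set.mem_ofPred_eq, hB, mem_filter, childless, not_and, not_forall,
      not_not] at hw
    obtain ⟨⟨hwH, hrw, hwi⟩, hch⟩ := hw
    obtain ⟨h', hh', h0, rfl⟩ := hch hwH
    refine ⟨h', ?_, rfl⟩
    have hlt' := hlt h' hh' h0
    have hne : h' ≠ i := fun h => hi (h ▸ hh')
    have hle : h' < i := by
      by_contra hcon
      rcases hact h' hh' (by omega) with h | h <;> omega
    simp only [coe_filter, Set.mem_ofPred_eq, hB, mem_filter]
    exact ⟨⟨hh', by omega, hle⟩, by omega⟩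
  have h4 : {w ∈ H | (r < w ∧ w < i) ∧ p w ≤ r} = {w ∈ B | p w ≤ r} := by
    rw [hB, filter_filter]
  have h5 : {w ∈ childless H p | r < w ∧ w < i} = {w ∈ B | w ∈ childless H p} := by
    ext w
    simp only [hB, childless, mem_filter]
    tauto
  rw [h4, h5]
  omega

/-- In a greedy set, the missed positions before a position `r` are at most as many as the childless
ones before `r`. Indeed, let `i` be the last missed position before `r`, and let `a < i` be the last
position with a child after `i`. No position missed from `a` to `i` is dominated by `a`, so these
are at most as many as the positions there that are dominated by `a`. The latter belong to the
set and have parents up to `a`, so `card_filter_between_le_card_childless` applies to them; the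
positions before `a` are dealt with by induction. -/
theorem IsGreedy.card_missed_le {E : ℕ → ℕ → Prop} {H : Finset ℕ} {p : ℕ → ℕ} {m : ℕ}
    (hG : IsGreedy E H p)
    (hmaj : ∀ r j, r < j → j ≤ m + 1 →
      #{w ∈ Ico (r + 1) j | ¬ E r w} ≤ #{w ∈ Ico (r + 1) j | E r w})
    (hHm : ∀ h ∈ H, h ≤ m) :
    ∀ r ∈ H, #{w ∈ range r | w ∉ H} ≤ #{w ∈ childless H p | w < r} := by
  intro r
  induction r using Nat.strong_induction_on with
  | _ r ih =>
    intro hr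
    rcases (({w ∈ range r | w ∉ H}).eq_empty_or_nonempty) with hem | hne
    · simp [hem]
    -- `i` is the last missed position before `r`, and `a` the last active one before `i`.
    obtain ⟨i, hi, himax⟩ := exists_max_image _ id hne
    simp only [mem_filter, mem_range, id] at hi himax
    obtain ⟨hir, hiH⟩ := hi
    have hneA : ({a ∈ H | a < i ∧ ∃ h ∈ H, i < h ∧ p h = a}).Nonempty := by
      obtain ⟨h, hh, hhmin⟩ := exists_min_image {h ∈ H | i < h} id ⟨r, by simp [hr, hir]⟩
      simp only [mem_filter, id] at hh hhmin
      have hpm := hG.par_mem h hh.1 (by omega)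
      have hpl := hG.par_lt h hh.1 (by omega)
      refine ⟨p h, ?_⟩
      simp only [mem_filter]
      refine ⟨hpm, ?_, h, hh.1, hh.2, rfl⟩
      have : p h ≠ i := fun h' => hiH (h' ▸ hpm)
      by_contra hcon
      have := hhmin (p h) ⟨hpm, by omega⟩
      omega
    obtain ⟨a, ha, hamax⟩ := exists_max_image _ id hneA
    simp only [mem_filter, id] at ha hamax
    obtain ⟨haH, hai, h, hh, hih, rfl⟩ := ha
    have hbetw := hG.between h hh (by omega)
    have h1 := ih (p h) (by omega) haH
    have him : i ≤ m := by have := hHm r hr; omega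
    have h2 := hmaj (p h) (i + 1) (by omega) (by omega)
    have h3 := card_filter_between_le_card_childless (r := p h) hG.par_lt hiH (by
      intro h' hh' hih'
      by_contra hcon
      have := hamax (p h') ⟨hG.par_mem h' hh' (by omega), by omega, h', hh', hih', rfl⟩
      omega)
    have h4 : #{w ∈ Ico (p h + 1) (i + 1) | E (p h) w} ≤
        #{w ∈ H | (p h < w ∧ w < i) ∧ p w ≤ p h} := by
      refine card_le_card fun w hw => ?_
      simp only [mem_filter, mem_Ico] at hw ⊢
      have := hbetw w (by omega) (by omega) hw.2
      have hne : w ≠ i := fun h' => hiH (h' ▸ this.1)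
      exact ⟨this.1, ⟨by omega, by omega⟩, this.2⟩
    have h5 : #{w ∈ range r | w ∉ H} ≤
        #{w ∈ range (p h) | w ∉ H} + #{w ∈ Ico (p h + 1) (i + 1) | ¬ E (p h) w} := by
      refine (card_le_card fun w hw => ?_).trans (card_union_le _ _)
      simp only [mem_filter, mem_union, mem_range, mem_Ico] at hw ⊢
      have hwi := himax w hw
      rcases lt_trichotomy w (p h) with hlt | heq | hgt
      · exact Or.inl ⟨hlt, hw.2⟩
      · exact absurd (heq ▸ haH) hw.2
      · exact Or.inr ⟨by omega, fun hE => hw.2 (hbetw w hgt (by omega) hE).1⟩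
    have h6 : #{w ∈ childless H p | w < p h} + #{w ∈ childless H p | p h < w ∧ w < i} ≤
        #{w ∈ childless H p | w < r} := by
      rw [← card_union_of_disjoint]
      · refine card_le_card fun w hw => ?_
        simp only [mem_filter, mem_union] at hw ⊢
        rcases hw with hw | hw <;> exact ⟨hw.1, by omega⟩
      · rw [disjoint_left]
        intro w hw hw'
        simp only [mem_filter] at hw hw'
        omega
    omega

/-! ### Rooted oriented trees, blocks and states of the embedding procedure -/

/-- A rooted oriented tree on `V`: every vertex other than the root is joined by an arc to its
parent, which has smaller rank. The arc is directed away from the root, from `par a` to `a`, if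
`fwd a` holds, and towards the root otherwise. The values `par root` and `fwd root` are irrelevant.
-/
structure RootedTree (V : Type*) where
  root : V
  par : V → V
  rank : V → ℕ
  rank_par_lt : ∀ a, a ≠ root → rank (par a) < rank a
  fwd : V → Prop

namespace RootedTree

variable {V : Type*} (A : RootedTree V)

/-- The vertex `a` has a child joined to it by a forward arc. -/
def HasFwdChild (a : V) : Prop := ∃ c, c ≠ A.root ∧ A.fwd c ∧ A.par c = a

/-- The map `φ` respects the arc between `a` and its parent. -/
def RespectsArc (E : ℕ → ℕ → Prop) (φ : V → ℕ) (a : V) : Prop :=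
  (A.fwd a → E (φ (A.par a)) (φ a)) ∧ (¬ A.fwd a → E (φ a) (φ (A.par a)))

/-- The map `φ` embeds the rooted tree into the vertices `S` of the digraph with arcs `E`. -/
structure IsEmbedding (E : ℕ → ℕ → Prop) (S : Finset ℕ) (φ : V → ℕ) : Prop where
  inj : Function.Injective φ
  mem : ∀ a, φ a ∈ S
  arc : ∀ a, a ≠ A.root → A.RespectsArc E φ a

/-- The tops are the root and the vertices entered by a forward arc. They are the roots of the
*blocks*, the components left after the deletion of all forward arcs. -/
def IsTop (a : V) : Prop := a = A.root ∨ A.fwd a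

/-- The top of the block of `a`. -/
noncomputable def top (a : V) : V :=
  if _h : A.IsTop a then a else top (A.par a)
termination_by A.rank a
decreasing_by exact A.rank_par_lt a fun h => _h (Or.inl h)

variable {A}

lemma top_of_isTop {a : V} (h : A.IsTop a) : A.top a = a := by
  rw [top, dif_pos h]

lemma top_of_not_isTop {a : V} (h : ¬ A.IsTop a) : A.top a = A.top (A.par a) := by
  rw [top, dif_neg h]

lemma isTop_top (a : V) : A.IsTop (A.top a) := by
  induction h : A.rank a using Nat.strong_induction_on generalizing a with
  | _ n ih =>
    by_cases ha : A.IsTop a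
    · rwa [top_of_isTop ha]
    · rw [top_of_not_isTop ha]
      exact ih _ (h ▸ A.rank_par_lt a fun h => ha (Or.inl h)) _ rfl

variable (A) in
/-- The vertex `c` is a child of `b`, joined to it by a forward arc. -/
def FwdStep (b c : V) : Prop := c ≠ A.root ∧ A.fwd c ∧ A.par c = b

/-- Forward arcs lead from every vertex to one without forward child. -/
lemma exists_fwd_descendant [Finite V] (z : V) :
    ∃ w, Relation.ReflTransGen A.FwdStep z w ∧ ¬ A.HasFwdChild w := by
  obtain ⟨w, hw, hmax⟩ := Set.exists_max_image {w | Relation.ReflTransGen A.FwdStep z w} A.rank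
    (Set.toFinite _) ⟨z, Relation.ReflTransGen.refl⟩
  refine ⟨w, hw, fun ⟨c, hc, hf, hp⟩ => ?_⟩
  have h1 := hmax c (Relation.ReflTransGen.tail hw ⟨hc, hf, hp⟩)
  have h2 := A.rank_par_lt c hc
  rw [hp] at h2
  omega

/-- Two vertices with a common forward descendant are comparable. -/
lemma fwdStep_total {z z' w : V} (h : Relation.ReflTransGen A.FwdStep z w)
    (h' : Relation.ReflTransGen A.FwdStep z' w) :
    Relation.ReflTransGen A.FwdStep z z' ∨ Relation.ReflTransGen A.FwdStep z' z := by
  have hU : Relator.RightUnique (Function.swap A.FwdStep) := by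
    rintro a b c ⟨_, _, rfl⟩ ⟨_, _, rfl⟩
    rfl
  rcases Relation.ReflTransGen.total_of_right_unique hU h.swap h'.swap with h | h
  · exact Or.inr h.swap
  · exact Or.inl h.swap

section Block

variable [Fintype V]

variable (A) in
/-- The block with top `τ`: the vertices that are joined to `τ` by a path of backward arcs. -/
noncomputable def block (τ : V) : Finset V := {a | A.top a = τ}

variable (A) in
/-- The total number of vertices that are reserved in excess of the sizes of the blocks, if `g τ`
vertices are reserved for the block with top `τ`. -/
noncomputable def excess (g : V → ℕ) : ℕ := ∑ τ with A.IsTop τ, (g τ - #(A.block τ))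

variable (A) in
/-- The tops of the blocks that are attached to `a` by a forward arc. -/
noncomputable def childTops (a : V) : Finset V := {τ | A.FwdStep a τ}

lemma mem_childTops {a τ : V} : τ ∈ A.childTops a ↔ A.FwdStep a τ := by simp [childTops]

lemma mem_block {a τ : V} : a ∈ A.block τ ↔ A.top a = τ := by simp [block]

lemma one_le_card_block {τ : V} (h : A.IsTop τ) : 1 ≤ #(A.block τ) :=
  card_pos.2 ⟨τ, mem_block.2 (top_of_isTop h)⟩

lemma card_filter_top_mem (Θ : Finset V) :
    #{b | A.top b ∈ Θ} = ∑ τ ∈ Θ, #(A.block τ) := by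
  rw [card_eq_sum_card_fiberwise (f := A.top) (t := Θ) (by intro b hb; simpa using hb)]
  refine sum_congr rfl fun τ hτ => ?_
  congr 1
  ext b
  simp only [mem_filter, mem_univ, true_and, mem_block]
  exact ⟨fun h => h.2, fun h => ⟨h ▸ hτ, h⟩⟩

variable (A) in
/-- A state of the embedding procedure after the positions before `i` have been treated, where
`g τ` positions are reserved for the block with top `τ`. The vertices in `D` have been placed by
`φ`; the positions in `H` are reserved, those other than `0` and outside `φ '' D` being wasted; and
`p h` is the position at whose treatment `h` has been reserved. Position `0` is a virtual vertex
that reserves the positions for the block of the root. -/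
structure EmbeddingState (g : V → ℕ) (E : ℕ → ℕ → Prop) (m i : ℕ) (D : Finset V) (φ : V → ℕ)
    (H : Finset ℕ) (p : ℕ → ℕ) : Prop where
  greedy : IsGreedy E H p
  le_of_mem : ∀ h ∈ H, h ≤ m
  par_lt : ∀ h ∈ H, h ≠ 0 → p h < i
  mem : ∀ a ∈ D, φ a ∈ H ∧ φ a ≠ 0
  inj : Set.InjOn φ D
  root_mem : A.root ∈ D
  bwd_mem : ∀ a, ¬ A.IsTop a → (a ∈ D ↔ A.par a ∈ D)
  fwd_mem : ∀ a, a ≠ A.root → A.fwd a → (a ∈ D ↔ A.par a ∈ D ∧ φ (A.par a) < i)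
  arc : ∀ a ∈ D, a ≠ A.root → A.RespectsArc E φ a
  card_eq : #H = 1 + #D + ∑ τ ∈ D with A.IsTop τ, (g τ - #(A.block τ))
  child : ∀ a ∈ D, φ a < i → A.HasFwdChild a → ∃ h ∈ H, h ≠ 0 ∧ p h = φ a
  zero_child : ∃ h ∈ H, h ≠ 0 ∧ p h = 0

namespace EmbeddingState

variable {g : V → ℕ} {E : ℕ → ℕ → Prop} {m i : ℕ} {D : Finset V} {φ : V → ℕ} {H : Finset ℕ}
  {p : ℕ → ℕ}

lemma mem_iff_top_mem (hs : A.EmbeddingState g E m i D φ H p) (b : V) :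
    b ∈ D ↔ A.top b ∈ D := by
  induction h : A.rank b using Nat.strong_induction_on generalizing b with
  | _ n ih =>
    by_cases hb : A.IsTop b
    · rw [top_of_isTop hb]
    · rw [top_of_not_isTop hb, hs.bwd_mem b hb]
      exact ih _ (h ▸ A.rank_par_lt b fun h => hb (Or.inl h)) _ rfl

lemma notMem_of_transGen (hs : A.EmbeddingState g E m i D φ H p) {z w : V}
    (hz : z ∉ D ∨ i ≤ φ z) (hzw : Relation.TransGen A.FwdStep z w) : w ∉ D := by
  induction hzw with
  | single h =>
    obtain ⟨h1, h2, rfl⟩ := h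
    rw [hs.fwd_mem _ h1 h2]
    rintro ⟨h3, h4⟩
    rcases hz with hz | hz
    · exact hz h3
    · omega
  | tail _ h ih =>
    obtain ⟨h1, h2, rfl⟩ := h
    rw [hs.fwd_mem _ h1 h2]
    exact fun h3 => ih h3.1

/-- While the vertex `a` at position `i` is treated, the vertices of the blocks to be reserved, and
the other vertices that are placed but not yet treated and that have a forward child, have distinct
forward descendants without forward children outside `D`. -/
lemma card_add_card_le (hs : A.EmbeddingState g E m i D φ H p) {a : V} (haD : a ∈ D)
    (hai : φ a = i) :
    #{b | A.top b ∈ A.childTops a} +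
      #{b ∈ D | b ≠ a ∧ A.HasFwdChild b ∧ i ≤ φ b} ≤
      #{b | ¬ A.HasFwdChild b ∧ b ∉ D} := by
  have hU : ∀ b, A.FwdStep a (A.top b) → b ∉ D := by
    rintro b ⟨h1, h2, h3⟩ hb
    rw [hs.mem_iff_top_mem, hs.fwd_mem _ h1 h2, h3] at hb
    omega
  rw [← card_union_of_disjoint]
  -- Two of the vertices in question cannot have the same forward descendant, since one of them
  -- would be a forward ancestor of the other.
  · choose e he1 he2 using A.exists_fwd_descendant
    have hZ : ∀ z ∈ ({b | A.top b ∈ A.childTops a} : Finset V) ∪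
        {b ∈ D | b ≠ a ∧ A.HasFwdChild b ∧ i ≤ φ b},
        (z ∉ D ∨ i ≤ φ z) ∧ z ≠ a ∧ (z ∈ D → A.HasFwdChild z) ∧
          (z ∉ D → A.FwdStep a (A.top z)) := by
      intro z hz
      simp only [mem_union, mem_filter, mem_univ, true_and, mem_childTops] at hz
      rcases hz with hz | hz
      · have := hU z hz
        exact ⟨Or.inl this, fun h => this (h ▸ haD), fun h => absurd h this, fun _ => hz⟩
      · exact ⟨Or.inr hz.2.2.2, hz.2.1, fun _ => hz.2.2.1, fun h => absurd hz.1 h⟩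
    have key : ∀ z, (z ∉ D ∨ i ≤ φ z) → z ≠ a → ∀ z', (z' ∉ D → A.FwdStep a (A.top z')) →
        Relation.ReflTransGen A.FwdStep z z' → z = z' := by
      intro z hz hza z' hz' hzz'
      rcases Relation.reflTransGen_iff_eq_or_transGen.1 hzz' with h | h
      · exact h.symm
      · have hz'D := hs.notMem_of_transGen hz h
        obtain ⟨y, hy, hy'⟩ := Relation.TransGen.tail'_iff.1 h
        have htop : A.top z' = z' := top_of_isTop (Or.inr hy'.2.1)
        have hya : y = a := by rw [← hy'.2.2, ← (hz' hz'D).2.2, htop]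
        subst hya
        rcases Relation.reflTransGen_iff_eq_or_transGen.1 hy with h1 | h1
        · exact absurd h1.symm hza
        · exact absurd haD (hs.notMem_of_transGen hz h1)
    refine card_le_card_of_injOn e ?_ ?_
    · intro z hz
      obtain ⟨h1, h2, h3, h4⟩ := hZ z hz
      simp only [coe_filter, mem_univ, true_and, Set.mem_ofPred_eq]
      refine ⟨he2 z, ?_⟩
      rcases Relation.reflTransGen_iff_eq_or_transGen.1 (he1 z) with h | h
      · have h6 := he2 z
        rw [h] at h6 ⊢
        exact fun hzD => h6 (h3 hzD)
      · exact hs.notMem_of_transGen h1 h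
    · intro z hz z' hz' hzz'
      obtain ⟨h1, h2, h3, h4⟩ := hZ z hz
      obtain ⟨h1', h2', h3', h4'⟩ := hZ z' hz'
      have h5 := he1 z'
      rw [← hzz'] at h5
      rcases fwdStep_total (he1 z) h5 with h | h
      · exact key z h1 h2 z' h4' h
      · exact (key z' h1' h2' z h4 h).symm
  · rw [disjoint_left]
    intro b hb hb'
    simp only [mem_filter, mem_univ, true_and, mem_childTops] at hb hb'
    exact hU b hb hb'.1

end EmbeddingState

end Block

end RootedTree

/-! ### The embedding procedure does not get stuck -/

/-- A finite set of natural numbers has initial segments of all smaller sizes. -/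
lemma exists_initial_segment (N : Finset ℕ) (d : ℕ) (hd : d ≤ #N) :
    ∃ N' ⊆ N, #N' = d ∧ ∀ w ∈ N, ∀ h ∈ N', w < h → w ∈ N' := by
  induction d with
  | zero => exact ⟨∅, by simp, by simp, by simp⟩
  | succ d ih =>
    obtain ⟨N', hsub, hcard, hdown⟩ := ih (by omega)
    have hne : (N \ N').Nonempty := by
      rw [← card_pos, card_sdiff_of_subset hsub]; omega
    obtain ⟨x, hx, hmin⟩ := exists_min_image _ id hne
    simp only [mem_sdiff, id] at hx hmin
    refine ⟨insert x N', insert_subset hx.1 hsub, by rw [card_insert_of_notMem hx.2, hcard], ?_⟩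
    intro w hw h hh hwh
    by_contra hcon
    rw [mem_insert, not_or] at hcon
    rcases mem_insert.1 hh with rfl | hh
    · have := hmin w ⟨hw, hcon.2⟩; omega
    · exact hcon.2 (hdown w hw h hh hwh)

lemma exists_disjoint_subsets {V : Type*} (Θ : Finset V) (g : V → ℕ) (N : Finset ℕ)
    (h : ∑ τ ∈ Θ, g τ ≤ #N) :
    ∃ S : V → Finset ℕ, (∀ τ ∈ Θ, S τ ⊆ N ∧ #(S τ) = g τ) ∧
      ∀ τ ∈ Θ, ∀ τ' ∈ Θ, τ ≠ τ' → Disjoint (S τ) (S τ') := by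
  induction Θ using Finset.induction_on generalizing N with
  | empty => exact ⟨fun _ => ∅, by simp, by simp⟩
  | insert a Θ ha ih =>
    rw [sum_insert ha] at h
    obtain ⟨N₁, hN₁, hc⟩ := exists_subset_card_eq (show g a ≤ #N by omega)
    obtain ⟨S, hS, hd⟩ := ih (N \ N₁) (by rw [card_sdiff_of_subset hN₁]; omega)
    have hne : ∀ τ ∈ Θ, τ ≠ a := fun τ hτ h => ha (h ▸ hτ)
    refine ⟨Function.update S a N₁, ?_, ?_⟩
    · intro τ hτ
      rcases mem_insert.1 hτ with rfl | hτ
      · simpa using ⟨hN₁, hc⟩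
      · rw [Function.update_of_ne (hne τ hτ)]
        exact ⟨(hS τ hτ).1.trans sdiff_subset, (hS τ hτ).2⟩
    · have hda : ∀ τ ∈ Θ, Disjoint N₁ (S τ) := fun τ hτ =>
        disjoint_sdiff.mono_right (hS τ hτ).1
      intro τ hτ τ' hτ' hττ'
      rcases mem_insert.1 hτ with h₁ | h₁ <;> rcases mem_insert.1 hτ' with h₂ | h₂
      · exact absurd (h₁.trans h₂.symm) hττ'
      · rw [h₁, Function.update_self, Function.update_of_ne (hne τ' h₂)]
        exact hda τ' h₂
      · rw [h₂, Function.update_self, Function.update_of_ne (hne τ h₁)]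
        exact (hda τ h₁).symm
      · rw [Function.update_of_ne (hne τ' h₂), Function.update_of_ne (hne τ h₁)]
        exact hd τ h₁ τ' h₂ hττ'

namespace RootedTree

variable {V : Type*} {A : RootedTree V} [Fintype V]

namespace EmbeddingState

variable {g : V → ℕ} {E : ℕ → ℕ → Prop} {m i : ℕ} {D : Finset V} {φ : V → ℕ} {H : Finset ℕ}
  {p : ℕ → ℕ}

lemma not_top_mem_childTops (hs : A.EmbeddingState g E m i D φ H p) {a : V}
    (hai : φ a = i) {b : V} (hb : b ∈ D) : A.top b ∉ A.childTops a := by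
  intro h
  obtain ⟨h1, h2, h3⟩ := mem_childTops.1 h
  rw [hs.mem_iff_top_mem, hs.fwd_mem _ h1 h2, h3] at hb
  omega

/-- If the vertex placed at position `i` has too few free out-neighbours for the blocks attached to
it, then there are too few positions. -/
lemma lt_of_stuck (hs : A.EmbeddingState g E m i D φ H p) {a : V}
    (hmaj : ∀ r j, r < j → j ≤ m + 1 →
      #{w ∈ Ico (r + 1) j | ¬ E r w} ≤ #{w ∈ Ico (r + 1) j | E r w})
    (hg : ∀ τ, A.IsTop τ → #(A.block τ) ≤ g τ) (haD : a ∈ D) (hai : φ a = i)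
    (hN : #{w ∈ Ico (i + 1) (m + 1) | w ∉ H ∧ E i w} < ∑ τ ∈ A.childTops a, g τ) :
    m + 1 < Fintype.card V + #{a | ¬ A.HasFwdChild a} + 2 * A.excess g := by
  set N := {w ∈ Ico (i + 1) (m + 1) | w ∉ H ∧ E i w} with hNdef
  -- With the free out-neighbours of `i` added as children of `i`, the set remains greedy.
  set H' := H ∪ N with hH'
  set p' : ℕ → ℕ := fun h => if h ∈ N then i else p h with hp'
  have hNmem : ∀ w, w ∈ N ↔ (i + 1 ≤ w ∧ w < m + 1) ∧ w ∉ H ∧ E i w := fun w => by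
    simp [hNdef]
  have hpN : ∀ w ∈ N, p' w = i := fun w hw => by simp [hp', hw]
  have hpH : ∀ w ∈ H, p' w = p w := fun w hw => by
    have : w ∉ N := fun h => ((hNmem w).1 h).2.1 hw
    simp [hp', this]
  have hiH : i ∈ H := hai ▸ (hs.mem a haD).1
  have him : i ≤ m := hs.le_of_mem i hiH
  have hp'i : ∀ w ∈ H', w ≠ 0 → p' w ≤ i := by
    intro w hw h0
    rcases mem_union.1 hw with hw | hw
    · rw [hpH w hw]; exact (hs.par_lt w hw h0).le
    · rw [hpN w hw]
  have hG : IsGreedy E H' p' := by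
    refine ⟨mem_union_left _ hs.greedy.zero_mem, ?_, ?_, ?_⟩
    · intro h hh h0
      rcases mem_union.1 hh with hh | hh
      · rw [hpH h hh]; exact mem_union_left _ (hs.greedy.par_mem h hh h0)
      · rw [hpN h hh]; exact mem_union_left _ hiH
    · intro h hh h0
      rcases mem_union.1 hh with hh | hh
      · rw [hpH h hh]; exact hs.greedy.par_lt h hh h0
      · rw [hpN h hh]; have := (hNmem h).1 hh; omega
    · intro h hh h0 w hw hwh hE
      rcases mem_union.1 hh with hh | hh
      · rw [hpH h hh] at hw hE ⊢
        obtain ⟨h1, h2⟩ := hs.greedy.between h hh h0 w hw hwh hE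
        exact ⟨mem_union_left _ h1, by rwa [hpH w h1]⟩
      · rw [hpN h hh] at hw hE ⊢
        have h1 := (hNmem h).1 hh
        have h2 : w ∈ H' := by
          by_cases hwH : w ∈ H
          · exact mem_union_left _ hwH
          · exact mem_union_right _ ((hNmem w).2 ⟨by omega, hwH, hE⟩)
        exact ⟨h2, hp'i w h2 (by omega)⟩
  have hH'm : ∀ h ∈ H', h ≤ m := by
    intro h hh
    rcases mem_union.1 hh with hh | hh
    · exact hs.le_of_mem h hh
    · have := (hNmem h).1 hh; omega
  have h1 := hG.card_missed_le hmaj hH'm i (mem_union_left _ hiH)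
  have h2 := hmaj i (m + 1) (by omega) le_rfl
  have h3 : #{w ∈ Ico (i + 1) (m + 1) | E i w} ≤ #{w ∈ childless H' p' | i < w} := by
    refine card_le_card fun w hw => ?_
    simp only [mem_filter, mem_Ico, childless] at hw ⊢
    refine ⟨⟨?_, fun h' hh' h0 h => ?_⟩, by omega⟩
    · by_cases hwH : w ∈ H
      · exact mem_union_left _ hwH
      · exact mem_union_right _ ((hNmem w).2 ⟨by omega, hwH, hw.2⟩)
    · have := hp'i h' hh' h0; omega
  -- The missed positions before `i` and the positions after `i` not dominated by `i` are at most as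
  -- many as the childless elements, of which there are few: those in `N`, the wasted positions, and
  -- those occupied by a vertex without forward child or not yet treated.
  have h4 : m + 1 ≤ #H' + (#{w ∈ range i | w ∉ H'} + #{w ∈ Ico (i + 1) (m + 1) | ¬ E i w}) := by
    have h : range (m + 1) ⊆ H' ∪ ({w ∈ range i | w ∉ H'} ∪
        {w ∈ Ico (i + 1) (m + 1) | ¬ E i w}) := by
      intro w hw
      simp only [mem_union, mem_filter, mem_range, mem_Ico] at hw ⊢
      by_cases hwH : w ∈ H'
      · exact Or.inl hwH
      · right
        rcases lt_trichotomy w i with hlt | heq | hgt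
        · exact Or.inl ⟨hlt, hwH⟩
        · exact absurd (heq ▸ mem_union_left _ hiH) hwH
        · refine Or.inr ⟨by omega, fun hE => hwH (mem_union_right _ ((hNmem w).2
            ⟨by omega, fun h => hwH (mem_union_left _ h), hE⟩))⟩
    have := card_le_card h
    rw [card_range] at this
    exact this.trans ((card_union_le _ _).trans (by gcongr; exact card_union_le _ _))
  set D₀ := {b ∈ D | b ≠ a ∧ (¬ A.HasFwdChild b ∨ i ≤ φ b)} with hD₀
  have h5 : #{w ∈ childless H' p' | w < i} + #{w ∈ childless H' p' | i < w} ≤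
      #N + #((H.erase 0) \ D.image φ) + #D₀ := by
    rw [← card_union_of_disjoint (by
      rw [disjoint_left]; intro w hw hw'; simp only [mem_filter] at hw hw'; omega)]
    have h : {w ∈ childless H' p' | w < i} ∪ {w ∈ childless H' p' | i < w} ⊆
        N ∪ ((H.erase 0) \ D.image φ) ∪ D₀.image φ := by
      intro w hw
      have hw' : w ∈ childless H' p' ∧ w ≠ i := by
        simp only [mem_union, mem_filter] at hw
        rcases hw with hw | hw <;> exact ⟨hw.1, by omega⟩
      obtain ⟨hw, hwi⟩ := hw'
      simp only [childless, mem_filter] at hw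
      obtain ⟨hwH', hch⟩ := hw
      rcases mem_union.1 hwH' with hwH | hwN
      · by_cases hwD : w ∈ D.image φ
        · obtain ⟨b, hb, rfl⟩ := mem_image.1 hwD
          refine mem_union_right _ (mem_image_of_mem _ ?_)
          simp only [hD₀, mem_filter]
          refine ⟨hb, fun h => hwi (h ▸ hai), ?_⟩
          by_contra hcon
          push Not at hcon
          obtain ⟨h, hh, h0, hph⟩ := hs.child b hb hcon.2 hcon.1
          exact hch h (mem_union_left _ hh) h0 (by rw [hpH h hh, hph])
        · refine mem_union_left _ (mem_union_right _ (mem_sdiff.2 ⟨mem_erase.2 ⟨?_, hwH⟩, hwD⟩))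
          rintro rfl
          obtain ⟨h, hh, h0, hph⟩ := hs.zero_child
          exact hch h (mem_union_left _ hh) h0 (by rw [hpH h hh, hph])
      · exact mem_union_left _ (mem_union_left _ hwN)
    refine (card_le_card h).trans ((card_union_le _ _).trans ?_)
    gcongr
    · exact card_union_le _ _
    · exact card_image_le
  have h6 : #((H.erase 0) \ D.image φ) + #D + 1 = #H := by
    rw [card_sdiff_of_subset, card_erase_of_mem hs.greedy.zero_mem, card_image_of_injOn hs.inj]
    · have := hs.card_eq; omega
    · intro w hw
      obtain ⟨b, hb, rfl⟩ := mem_image.1 hw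
      exact mem_erase.2 ⟨(hs.mem b hb).2, (hs.mem b hb).1⟩
  have h7 : #H' ≤ #H + #N := card_union_le _ _
  have h8 := hs.card_eq
  set Θ := A.childTops a with hΘ
  set U : Finset V := {b | A.top b ∈ Θ} with hU
  have hΘtop : ∀ τ ∈ Θ, A.IsTop τ := fun τ hτ => Or.inr (mem_childTops.1 hτ).2.1
  have h9 : ∑ τ ∈ Θ, g τ = #U + ∑ τ ∈ Θ, (g τ - #(A.block τ)) := by
    rw [hU, card_filter_top_mem, ← sum_add_distrib]
    exact sum_congr rfl fun τ hτ => by have := hg τ (hΘtop τ hτ); omega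
  have h10 : ∑ τ ∈ D with A.IsTop τ, (g τ - #(A.block τ)) + ∑ τ ∈ Θ, (g τ - #(A.block τ)) ≤
      A.excess g := by
    rw [← sum_union]
    · refine sum_le_sum_of_subset fun τ hτ => ?_
      rcases mem_union.1 hτ with hτ | hτ
      · simpa using (mem_filter.1 hτ).2
      · simpa using hΘtop τ hτ
    · rw [disjoint_left]
      intro τ hτ hτ'
      have := hs.not_top_mem_childTops hai (mem_filter.1 hτ).1
      rw [top_of_isTop (hΘtop τ hτ')] at this
      exact this hτ'
  have h11 : #U + _ ≤ _ := hs.card_add_card_le haD hai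
  have h12 : #D₀ ≤ #{b ∈ D | ¬ A.HasFwdChild b} +
      #{b ∈ D | b ≠ a ∧ A.HasFwdChild b ∧ i ≤ φ b} := by
    refine (card_le_card fun b hb => ?_).trans (card_union_le _ _)
    simp only [hD₀, mem_union, mem_filter] at hb ⊢
    tauto
  have h13 : #({a | ¬ A.HasFwdChild a} : Finset V) = #{b ∈ D | ¬ A.HasFwdChild b} +
      #{b | ¬ A.HasFwdChild b ∧ b ∉ D} := by
    rw [← card_filter_add_card_filter_not (s := {a | ¬ A.HasFwdChild a}) (fun b => b ∈ D)]
    congr 2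
    · ext b; simp [and_comm]
    · ext b; simp
  have h14 : #D + #U ≤ Fintype.card V := by
    rw [← card_union_of_disjoint]
    · exact card_le_univ _
    · rw [disjoint_left]
      intro b hb hb'
      exact hs.not_top_mem_childTops hai hb (by simpa [hU] using hb')
  omega

end EmbeddingState

end RootedTree

/-! ### The embedding procedure -/

namespace RootedTree

variable {V : Type*} {A : RootedTree V} [Fintype V]

namespace EmbeddingState

variable {g : V → ℕ} {E : ℕ → ℕ → Prop} {m i : ℕ} {D : Finset V} {φ : V → ℕ} {H : Finset ℕ}
  {p : ℕ → ℕ}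

/-- Nothing has to be done at a position that carries no vertex with a forward child. -/
lemma skip (hs : A.EmbeddingState g E m i D φ H p)
    (h : ∀ a ∈ D, φ a = i → ¬ A.HasFwdChild a) : A.EmbeddingState g E m (i + 1) D φ H p where
  greedy := hs.greedy
  le_of_mem := hs.le_of_mem
  par_lt h hh h0 := (hs.par_lt h hh h0).trans i.lt_succ_self
  mem := hs.mem
  inj := hs.inj
  root_mem := hs.root_mem
  bwd_mem := hs.bwd_mem
  fwd_mem a ha hf := by
    rw [hs.fwd_mem a ha hf]
    refine and_congr_right fun hp => ?_
    have : φ (A.par a) ≠ i := fun h' => h _ hp h' ⟨a, ha, hf, rfl⟩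
    omega
  arc := hs.arc
  card_eq := hs.card_eq
  child a ha hai hf := by
    have : φ a ≠ i := fun h' => h a ha h' hf
    exact hs.child a ha (by omega) hf
  zero_child := hs.zero_child

/-- If the vertex placed at position `i` has enough free out-neighbours, then the first of them are
reserved for the blocks attached to it. -/
lemma extend (hs : A.EmbeddingState g E m i D φ H p) {a : V}
    (hg : ∀ τ, A.IsTop τ → #(A.block τ) ≤ g τ)
    (hblock : ∀ τ, A.IsTop τ → ∀ S ⊆ Icc 1 m, g τ ≤ #S → ∃ ψ : V → ℕ,
      Set.InjOn ψ (A.block τ) ∧ ∀ a ∈ A.block τ, ψ a ∈ S ∧ (a ≠ τ → E (ψ a) (ψ (A.par a))))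
    (haD : a ∈ D) (hai : φ a = i) (hfa : A.HasFwdChild a)
    (hN : ∑ τ ∈ A.childTops a, g τ ≤ #{w ∈ Ico (i + 1) (m + 1) | w ∉ H ∧ E i w}) :
    ∃ D φ H p, A.EmbeddingState g E m (i + 1) D φ H p := by
  obtain ⟨N, hNsub, hNcard, hNdown⟩ := exists_initial_segment _ _ hN
  have hNmem : ∀ w ∈ N, (i + 1 ≤ w ∧ w < m + 1) ∧ w ∉ H ∧ E i w := fun w hw => by
    simpa using hNsub hw
  obtain ⟨S, hS, hSd⟩ := exists_disjoint_subsets (A.childTops a) g N hNcard.ge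
  have hΘtop : ∀ τ ∈ A.childTops a, A.IsTop τ := fun τ hτ => Or.inr (mem_childTops.1 hτ).2.1
  have hψ : ∀ τ, ∃ ψ : V → ℕ, τ ∈ A.childTops a → (Set.InjOn ψ (A.block τ) ∧
      ∀ a ∈ A.block τ, ψ a ∈ S τ ∧ (a ≠ τ → E (ψ a) (ψ (A.par a)))) := by
    intro τ
    by_cases hτ : τ ∈ A.childTops a
    · obtain ⟨ψ, h⟩ := hblock τ (hΘtop τ hτ) (S τ) (fun w hw => by
        have := hNmem w ((hS τ hτ).1 hw)
        rw [mem_Icc]; omega) (hS τ hτ).2.ge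
      exact ⟨ψ, fun _ => h⟩
    · exact ⟨fun _ => 0, fun h => absurd h hτ⟩
  choose ψ hψ using hψ
  set U : Finset V := {b | A.top b ∈ A.childTops a} with hU
  have hUmem : ∀ b, b ∈ U ↔ A.top b ∈ A.childTops a := fun b => by simp [hU]
  have hDU : ∀ b ∈ D, b ∉ U := fun b hb h =>
    hs.not_top_mem_childTops hai hb ((hUmem b).1 h)
  set φ' : V → ℕ := fun b => if b ∈ U then ψ (A.top b) b else φ b with hφ'
  have hφU : ∀ b ∈ U, φ' b = ψ (A.top b) b := fun b hb => by simp [hφ', hb]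
  have hφD : ∀ b ∈ D, φ' b = φ b := fun b hb => by simp [hφ', hDU b hb]
  have hφS : ∀ b ∈ U, φ' b ∈ S (A.top b) := fun b hb => by
    rw [hφU b hb]
    exact ((hψ _ ((hUmem b).1 hb)).2 b (mem_block.2 rfl)).1
  have hφN : ∀ b ∈ U, φ' b ∈ N := fun b hb => (hS _ ((hUmem b).1 hb)).1 (hφS b hb)
  set p' : ℕ → ℕ := fun h => if h ∈ N then i else p h with hp'
  have hpN : ∀ w ∈ N, p' w = i := fun w hw => by simp [hp', hw]
  have hpH : ∀ w ∈ H, p' w = p w := fun w hw => by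
    have : w ∉ N := fun h => (hNmem w h).2.1 hw
    simp [hp', this]
  have hiH : i ∈ H := hai ▸ (hs.mem a haD).1
  have hp'i : ∀ w ∈ H ∪ N, w ≠ 0 → p' w < i + 1 := by
    intro w hw h0
    rcases mem_union.1 hw with hw | hw
    · rw [hpH w hw]; exact (hs.par_lt w hw h0).trans i.lt_succ_self
    · rw [hpN w hw]; exact i.lt_succ_self
  have htopU : ∀ b ∈ U, A.IsTop b → A.FwdStep a b := fun b hb h => by
    rw [hUmem, top_of_isTop h] at hb
    exact mem_childTops.1 hb
  refine ⟨D ∪ U, φ', H ∪ N, p', ?_⟩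
  constructor
  · refine ⟨mem_union_left _ hs.greedy.zero_mem, ?_, ?_, ?_⟩
    · intro h hh h0
      rcases mem_union.1 hh with hh | hh
      · rw [hpH h hh]; exact mem_union_left _ (hs.greedy.par_mem h hh h0)
      · rw [hpN h hh]; exact mem_union_left _ hiH
    · intro h hh h0
      rcases mem_union.1 hh with hh | hh
      · rw [hpH h hh]; exact hs.greedy.par_lt h hh h0
      · rw [hpN h hh]; have := hNmem h hh; omega
    · intro h hh h0 w hw hwh hE
      rcases mem_union.1 hh with hh | hh
      · rw [hpH h hh] at hw hE ⊢
        obtain ⟨h1, h2⟩ := hs.greedy.between h hh h0 w hw hwh hE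
        exact ⟨mem_union_left _ h1, by rwa [hpH w h1]⟩
      · rw [hpN h hh] at hw hE ⊢
        have h1 := hNmem h hh
        have h2 : w ∈ H ∪ N := by
          by_cases hwH : w ∈ H
          · exact mem_union_left _ hwH
          · refine mem_union_right _ (hNdown w ?_ h hh hwh)
            simp only [mem_filter, mem_Ico]
            exact ⟨by omega, hwH, hE⟩
        exact ⟨h2, Nat.lt_succ_iff.1 (hp'i w h2 (by omega))⟩
  · intro h hh
    rcases mem_union.1 hh with hh | hh
    · exact hs.le_of_mem h hh
    · have := hNmem h hh; omega
  · exact hp'i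
  · intro b hb
    rcases mem_union.1 hb with hb | hb
    · rw [hφD b hb]; exact ⟨mem_union_left _ (hs.mem b hb).1, (hs.mem b hb).2⟩
    · have := hNmem _ (hφN b hb)
      exact ⟨mem_union_right _ (hφN b hb), by omega⟩
  · have hdis : ∀ b ∈ D, ∀ c ∈ U, φ' b ≠ φ' c := by
      intro b hb c hc h
      rw [hφD b hb] at h
      exact (hNmem _ (hφN c hc)).2.1 (h ▸ (hs.mem b hb).1)
    intro b hb c hc hbc
    rcases mem_union.1 hb with hb | hb <;> rcases mem_union.1 hc with hc | hc
    · rw [hφD b hb, hφD c hc] at hbc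
      exact hs.inj hb hc hbc
    · exact absurd hbc (hdis b hb c hc)
    · exact absurd hbc.symm (hdis c hc b hb)
    · by_cases htt : A.top b = A.top c
      · rw [hφU b hb, hφU c hc, htt] at hbc
        exact (hψ _ ((hUmem c).1 hc)).1 (mem_coe.2 (mem_block.2 htt)) (mem_coe.2 (mem_block.2 rfl))
          hbc
      · have := hSd _ ((hUmem b).1 hb) _ ((hUmem c).1 hc) htt
        exact absurd hbc (disjoint_iff_ne.1 this _ (hφS b hb) _ (hφS c hc))
  · exact mem_union_left _ hs.root_mem
  · intro b hb
    rw [mem_union, mem_union, hs.bwd_mem b hb, hUmem, hUmem, top_of_not_isTop hb]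
  · intro b hb hf
    have htop : A.top b = b := top_of_isTop (Or.inr hf)
    rw [mem_union, mem_union, hs.fwd_mem b hb hf, hUmem, htop, mem_childTops]
    constructor
    · rintro (⟨h1, h2⟩ | ⟨-, -, h3⟩)
      · exact ⟨Or.inl h1, by rw [hφD _ h1]; omega⟩
      · rw [h3]
        exact ⟨Or.inl haD, by rw [hφD _ haD]; omega⟩
    · rintro ⟨h1 | h1, h2⟩
      · rw [hφD _ h1] at h2
        by_cases h3 : φ (A.par b) = i
        · exact Or.inr ⟨hb, hf, hs.inj h1 haD (h3.trans hai.symm)⟩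
        · exact Or.inl ⟨h1, by omega⟩
      · have := hNmem _ (hφN _ h1)
        omega
  · intro b hb hbr
    by_cases hbt : A.IsTop b
    · have hfb : A.fwd b := hbt.resolve_left hbr
      refine ⟨fun _ => ?_, fun h => absurd hfb h⟩
      rcases mem_union.1 hb with hb | hb
      · rw [hφD b hb, hφD _ ((hs.fwd_mem b hbr hfb).1 hb).1]
        exact (hs.arc b hb hbr).1 hfb
      · rw [(htopU b hb hbt).2.2, hφD a haD, hai]
        exact (hNmem _ (hφN b hb)).2.2
    · refine ⟨fun h => absurd (Or.inr h) hbt, fun hfb => ?_⟩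
      rcases mem_union.1 hb with hb | hb
      · rw [hφD b hb, hφD _ ((hs.bwd_mem b hbt).1 hb)]
        exact (hs.arc b hb hbr).2 hfb
      · have htt := top_of_not_isTop hbt
        have hpU : A.par b ∈ U := by rwa [hUmem, ← htt, ← hUmem]
        rw [hφU b hb, hφU _ hpU, ← htt]
        refine ((hψ _ ((hUmem b).1 hb)).2 b (mem_block.2 rfl)).2 fun h => ?_
        rw [h] at hbt
        exact hbt (isTop_top b)
  · have h1 : ∑ τ ∈ A.childTops a, g τ =
        #U + ∑ τ ∈ A.childTops a, (g τ - #(A.block τ)) := by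
      rw [hU, card_filter_top_mem, ← sum_add_distrib]
      exact sum_congr rfl fun τ hτ => by have := hg τ (hΘtop τ hτ); omega
    have h2 : ({τ ∈ D ∪ U | A.IsTop τ} : Finset V) = {τ ∈ D | A.IsTop τ} ∪ A.childTops a := by
      ext τ
      simp only [mem_filter, mem_union]
      constructor
      · rintro ⟨h | h, ht⟩
        · exact Or.inl ⟨h, ht⟩
        · exact Or.inr (mem_childTops.2 (htopU τ h ht))
      · rintro (⟨h, ht⟩ | h)
        · exact ⟨Or.inl h, ht⟩
        · exact ⟨Or.inr ((hUmem τ).2 (by rwa [top_of_isTop (hΘtop τ h)])), hΘtop τ h⟩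
    rw [h2, sum_union, card_union_of_disjoint, card_union_of_disjoint, hs.card_eq, hNcard, h1]
    · omega
    · rw [disjoint_left]; exact hDU
    · rw [disjoint_left]; exact fun w hw hwN => (hNmem w hwN).2.1 hw
    · rw [disjoint_left]
      intro τ hτ hτ'
      refine hDU τ (mem_filter.1 hτ).1 ((hUmem τ).2 ?_)
      rwa [top_of_isTop (hΘtop τ hτ')]
  · intro b hb hbi hfb
    rcases mem_union.1 hb with hb | hb
    · rw [hφD b hb] at hbi ⊢
      by_cases hbi' : φ b = i
      · obtain ⟨c, hc⟩ := hfa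
        have hcΘ : c ∈ A.childTops a := mem_childTops.2 hc
        have hpos : 0 < #N := by
          rw [hNcard]
          refine lt_of_lt_of_le ?_ (single_le_sum (f := g) (fun _ _ => Nat.zero_le _) hcΘ)
          exact (one_le_card_block (hΘtop c hcΘ)).trans (hg c (hΘtop c hcΘ))
        obtain ⟨h, hh⟩ := card_pos.1 hpos
        have := hNmem h hh
        exact ⟨h, mem_union_right _ hh, by omega, by rw [hpN h hh, hbi']⟩
      · obtain ⟨h, hh, h0, hph⟩ := hs.child b hb (by omega) hfb
        exact ⟨h, mem_union_left _ hh, h0, by rw [hpH h hh, hph]⟩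
    · have := hNmem _ (hφN b hb); omega
  · obtain ⟨h, hh, h0, hph⟩ := hs.zero_child
    exact ⟨h, mem_union_left _ hh, h0, by rw [hpH h hh, hph]⟩

end EmbeddingState

variable {g : V → ℕ} {E : ℕ → ℕ → Prop} {m : ℕ}

/-- The initial state, in which the first `g root` positions are reserved for the block of the root.
-/
lemma exists_embeddingState_one (hg : ∀ τ, A.IsTop τ → #(A.block τ) ≤ g τ)
    (hblock : ∀ τ, A.IsTop τ → ∀ S ⊆ Icc 1 m, g τ ≤ #S → ∃ ψ : V → ℕ,
      Set.InjOn ψ (A.block τ) ∧ ∀ a ∈ A.block τ, ψ a ∈ S ∧ (a ≠ τ → E (ψ a) (ψ (A.par a))))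
    (hm : g A.root ≤ m) :
    ∃ D φ H p, A.EmbeddingState g E m 1 D φ H p := by
  have hr : A.IsTop A.root := Or.inl rfl
  have htr : A.top A.root = A.root := top_of_isTop hr
  have hN : #(Icc 1 (g A.root)) = g A.root := by simp
  obtain ⟨ψ, hinj, hψ⟩ := hblock A.root hr (Icc 1 (g A.root)) (Icc_subset_Icc_right hm) hN.ge
  have hψ0 : ∀ a ∈ A.block A.root, 1 ≤ ψ a ∧ ψ a ≤ g A.root := fun a ha =>
    mem_Icc.1 (hψ a ha).1
  have hpos : 1 ≤ g A.root := (one_le_card_block hr).trans (hg _ hr)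
  refine ⟨A.block A.root, ψ, Icc 0 (g A.root), fun _ => 0, ?_⟩
  constructor
  · refine ⟨by simp, by simp, fun h _ h0 => Nat.pos_of_ne_zero h0, ?_⟩
    intro h hh _ w _ hwh _
    rw [mem_Icc] at hh ⊢
    exact ⟨by omega, le_rfl⟩
  · intro h hh
    rw [mem_Icc] at hh
    omega
  · simp
  · intro a ha
    have := hψ0 a ha
    exact ⟨mem_Icc.2 (by omega), by omega⟩
  · exact hinj
  · exact mem_block.2 htr
  · intro a ha
    rw [mem_block, mem_block, top_of_not_isTop ha]
  · intro a ha hf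
    rw [mem_block, top_of_isTop (Or.inr hf)]
    refine ⟨fun h => absurd h ha, fun ⟨h1, h2⟩ => ?_⟩
    have := hψ0 _ h1
    omega
  · intro a ha har
    refine ⟨fun hf => ?_, fun _ => (hψ a ha).2 har⟩
    rw [mem_block, top_of_isTop (Or.inr hf)] at ha
    exact absurd ha har
  · have h2 : ({τ ∈ A.block A.root | A.IsTop τ} : Finset V) = {A.root} := by
      ext τ
      simp only [mem_filter, mem_block, mem_singleton]
      constructor
      · rintro ⟨h1, h2⟩
        rwa [top_of_isTop h2] at h1
      · rintro rfl
        exact ⟨htr, hr⟩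
    have := hg _ hr
    rw [h2, sum_singleton, Nat.card_Icc]
    omega
  · intro a ha h
    have := hψ0 a ha
    omega
  · exact ⟨1, mem_Icc.2 (by omega), one_ne_zero, rfl⟩

/-- The embedding procedure succeeds: a rooted tree embeds if the number of positions is at least
the number of vertices, plus the number of vertices without forward child, plus twice the excess of
the reservations for the blocks, minus one. -/
theorem exists_embedding_of_blocks (hg : ∀ τ, A.IsTop τ → #(A.block τ) ≤ g τ)
    (hmaj : ∀ r j, r < j → j ≤ m + 1 →
      #{w ∈ Ico (r + 1) j | ¬ E r w} ≤ #{w ∈ Ico (r + 1) j | E r w})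
    (hblock : ∀ τ, A.IsTop τ → ∀ S ⊆ Icc 1 m, g τ ≤ #S → ∃ ψ : V → ℕ,
      Set.InjOn ψ (A.block τ) ∧ ∀ a ∈ A.block τ, ψ a ∈ S ∧ (a ≠ τ → E (ψ a) (ψ (A.par a))))
    (hm : Fintype.card V + #{a | ¬ A.HasFwdChild a} + 2 * A.excess g ≤ m + 1) :
    ∃ φ, A.IsEmbedding E (Icc 1 m) φ := by
  have hr : A.IsTop A.root := Or.inl rfl
  have hroot : g A.root ≤ m := by
    have h1 : g A.root - #(A.block A.root) ≤ A.excess g :=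
      single_le_sum (f := fun τ => g τ - #(A.block τ)) (fun _ _ => Nat.zero_le _)
        (by simpa using hr)
    have h2 : #(A.block A.root) ≤ Fintype.card V := card_le_univ _
    have h3 : 0 < #({a | ¬ A.HasFwdChild a} : Finset V) := by
      obtain ⟨w, -, hw⟩ := A.exists_fwd_descendant A.root
      exact card_pos.2 ⟨w, by simpa using hw⟩
    omega
  have key : ∀ i, 1 ≤ i → i ≤ m + 1 → ∃ D φ H p, A.EmbeddingState g E m i D φ H p := by
    intro i hi
    induction i, hi using Nat.le_induction with
    | base => exact fun _ => exists_embeddingState_one hg hblock hroot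
    | succ i hi ih =>
      intro him
      obtain ⟨D, φ, H, p, hs⟩ := ih (by omega)
      by_cases hskip : ∀ a ∈ D, φ a = i → ¬ A.HasFwdChild a
      · exact ⟨D, φ, H, p, hs.skip hskip⟩
      · push Not at hskip
        obtain ⟨a, haD, hai, hfa⟩ := hskip
        refine hs.extend hg hblock haD hai hfa ?_
        by_contra hcon
        have := hs.lt_of_stuck hmaj hg haD hai (not_le.1 hcon)
        omega
  obtain ⟨D, φ, H, p, hs⟩ := key (m + 1) (by omega) le_rfl
  have hD : ∀ b, b ∈ D := by
    intro b
    induction h : A.rank b using Nat.strong_induction_on generalizing b with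
    | _ n ih =>
      by_cases hbr : b = A.root
      · rw [hbr]; exact hs.root_mem
      · have hp := ih _ (h ▸ A.rank_par_lt b hbr) _ rfl
        by_cases hf : A.fwd b
        · exact (hs.fwd_mem b hbr hf).2 ⟨hp, Nat.lt_succ_iff.2 (hs.le_of_mem _ (hs.mem _ hp).1)⟩
        · exact (hs.bwd_mem b fun h => h.elim hbr hf).2 hp
  refine ⟨φ, fun a b h => hs.inj (hD a) (hD b) h, fun a => ?_, fun a ha => hs.arc a (hD a) ha⟩
  have := hs.mem a (hD a)
  have := hs.le_of_mem _ this.1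
  rw [mem_Icc]
  omega

end RootedTree

/-! ### The bound for trees with few childless vertices -/

lemma IsTournamentOn.mono {E : ℕ → ℕ → Prop} {S S' : Finset ℕ} (h : IsTournamentOn E S)
    (hS : S' ⊆ S) : IsTournamentOn E S' :=
  fun x hx y hy hxy => h x (hS hx) y (hS hy) hxy

lemma IsTournamentOn.swap {E : ℕ → ℕ → Prop} {S : Finset ℕ} (h : IsTournamentOn E S) :
    IsTournamentOn (Function.swap E) S :=
  fun x hx y hy hxy => h y hy x hx hxy.symm

namespace RootedTree

variable {V : Type*}

/-- The rooted tree `A` is contained in every finite tournament with at least `m` vertices. -/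
def Unavoidable (A : RootedTree V) (m : ℕ) : Prop :=
  ∀ (E : ℕ → ℕ → Prop) (S : Finset ℕ), IsTournamentOn E S → m ≤ #S → ∃ φ, A.IsEmbedding E S φ

/-- The vertex `a` has a child joined to it by a backward arc. -/
def HasBwdChild (A : RootedTree V) (a : V) : Prop := ∃ c, c ≠ A.root ∧ ¬ A.fwd c ∧ A.par c = a

/-- The vertex `a` has a child. -/
def HasChild (A : RootedTree V) (a : V) : Prop := ∃ c, c ≠ A.root ∧ A.par c = a

/-- The rooted tree with all arcs reversed. -/
def reverse (A : RootedTree V) : RootedTree V := { A with fwd := fun a => ¬ A.fwd a }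

variable {A : RootedTree V}

lemma Unavoidable.of_reverse {m : ℕ} (h : A.reverse.Unavoidable m) : A.Unavoidable m := by
  intro E S hS hm
  obtain ⟨φ, hφ⟩ := h (Function.swap E) S hS.swap hm
  exact ⟨φ, hφ.inj, hφ.mem, fun a ha =>
    ⟨fun hf => (hφ.arc a ha).2 (not_not.2 hf), fun hf => (hφ.arc a ha).1 hf⟩⟩

lemma par_mem_block [Fintype V] {a τ : V} (ha : a ∈ A.block τ) (h : a ≠ τ) :
    ¬ A.IsTop a ∧ A.par a ∈ A.block τ := by
  rw [mem_block] at ha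
  have hnt : ¬ A.IsTop a := fun ht => h (by rw [← ha, top_of_isTop ht])
  exact ⟨hnt, mem_block.2 (by rw [← top_of_not_isTop hnt, ha])⟩

/-- The conclusion of the embedding procedure for arbitrary tournaments, if every block embeds into
every tournament with as many vertices as are reserved for the block. -/
lemma unavoidable_of_blocks [Fintype V] {g : V → ℕ} {m : ℕ}
    (hg : ∀ τ, A.IsTop τ → #(A.block τ) ≤ g τ)
    (hblock : ∀ τ, A.IsTop τ → ∀ E S, IsTournamentOn E S → g τ ≤ #S → ∃ ψ : V → ℕ,
      Set.InjOn ψ (A.block τ) ∧ ∀ a ∈ A.block τ, ψ a ∈ S ∧ (a ≠ τ → E (ψ a) (ψ (A.par a))))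
    (hm : Fintype.card V + #{a | ¬ A.HasFwdChild a} + 2 * A.excess g ≤ m + 1) :
    A.Unavoidable m := by
  intro E S hS hmS
  obtain ⟨e, hinj, hmem, hfwd, -⟩ := exists_median_order E S hS
  have hinj' : ∀ i ∈ Icc 1 #S, ∀ j ∈ Icc 1 #S, e (i - 1) = e (j - 1) → i = j := by
    intro i hi j hj hij
    rw [mem_Icc] at hi hj
    have := hinj (Set.mem_Iio.2 (show i - 1 < #S by omega))
      (Set.mem_Iio.2 (show j - 1 < #S by omega)) hij
    omega
  have hmem' : ∀ i ∈ Icc 1 #S, e (i - 1) ∈ S := by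
    intro i hi
    rw [mem_Icc] at hi
    exact hmem _ (by omega)
  -- Position `0` is a virtual vertex that dominates all the others.
  obtain ⟨E', hE'⟩ : ∃ E' : ℕ → ℕ → Prop, ∀ i j, E' i j ↔ i = 0 ∨ E (e (i - 1)) (e (j - 1)) :=
    ⟨_, fun _ _ => Iff.rfl⟩
  have hmaj : ∀ r j, r < j → j ≤ #S + 1 →
      #{w ∈ Ico (r + 1) j | ¬ E' r w} ≤ #{w ∈ Ico (r + 1) j | E' r w} := by
    intro r j hrj hj
    rcases Nat.eq_zero_or_pos r with rfl | hr
    · simp [hE']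
    · have hshift : ∀ P : ℕ → Prop,
          #{w ∈ Ico (r + 1) j | P (w - 1)} = #{w ∈ Ico (r - 1 + 1) (j - 1) | P w} := by
        intro P
        refine card_bij (fun w _ => w - 1) ?_ ?_ ?_
        · intro w hw
          simp only [mem_filter, mem_Ico] at hw ⊢
          exact ⟨by omega, hw.2⟩
        · intro w hw w' hw' h
          simp only [mem_filter, mem_Ico] at hw hw'
          omega
        · intro w hw
          simp only [mem_filter, mem_Ico] at hw
          refine ⟨w + 1, ?_, by omega⟩
          simp only [mem_filter, mem_Ico, Nat.add_sub_cancel]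
          exact ⟨by omega, hw.2⟩
      have hE'r : ∀ w, E' r w ↔ E (e (r - 1)) (e (w - 1)) := fun w => by
        rw [hE', or_iff_right (by omega)]
      have h1 : #{w ∈ Ico (r + 1) j | ¬ E' r w} =
          #{w ∈ Ico (r - 1 + 1) (j - 1) | ¬ E (e (r - 1)) (e w)} := by
        rw [filter_congr fun w _ => not_congr (hE'r w)]
        convert hshift fun w => ¬ E (e (r - 1)) (e w)
      have h2 : #{w ∈ Ico (r + 1) j | E' r w} =
          #{w ∈ Ico (r - 1 + 1) (j - 1) | E (e (r - 1)) (e w)} := by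
        rw [filter_congr fun w _ => hE'r w]
        exact hshift fun w => E (e (r - 1)) (e w)
      rw [h1, h2]
      exact hfwd (r - 1) (j - 1) (by omega) (by omega)
  obtain ⟨φ, hφ⟩ := exists_embedding_of_blocks (E := E') (m := #S) hg hmaj (by
    intro τ hτ S' hS' hgS'
    have himg : #(S'.image fun i => e (i - 1)) = #S' := card_image_of_injOn fun i hi j hj h =>
      hinj' i (hS' hi) j (hS' hj) h
    have hsub : S'.image (fun i => e (i - 1)) ⊆ S := by
      intro w hw
      obtain ⟨i, hi, rfl⟩ := mem_image.1 hw
      exact hmem' i (hS' hi)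
    obtain ⟨ψ, hψi, hψ⟩ := hblock τ hτ E _ (hS.mono hsub) (himg.symm ▸ hgS')
    have hex : ∀ a, ∃ i, a ∈ A.block τ → i ∈ S' ∧ e (i - 1) = ψ a := by
      intro a
      by_cases ha : a ∈ A.block τ
      · obtain ⟨i, hi, h⟩ := mem_image.1 (hψ a ha).1
        exact ⟨i, fun _ => ⟨hi, h⟩⟩
      · exact ⟨0, fun h => absurd h ha⟩
    choose χ hχ using hex
    refine ⟨χ, fun a ha b hb h => hψi ha hb ?_,
      fun a ha => ⟨(hχ a ha).1, fun haτ => (hE' _ _).2 (Or.inr ?_)⟩⟩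
    · rw [← (hχ a ha).2, ← (hχ b hb).2, h]
    · rw [(hχ a ha).2, (hχ _ (par_mem_block ha haτ).2).2]
      exact (hψ a ha).2 haτ) (by omega)
  have hpos : ∀ a, φ a ≠ 0 := fun a => by
    have := mem_Icc.1 (hφ.mem a)
    omega
  refine ⟨fun a => e (φ a - 1), fun a b h => hφ.inj (hinj' _ (hφ.mem a) _ (hφ.mem b) h),
    fun a => hmem' _ (hφ.mem a), fun a ha => ⟨fun hf => ?_, fun hf => ?_⟩⟩
  · exact ((hE' _ _).1 ((hφ.arc a ha).1 hf)).resolve_left (hpos _)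
  · exact ((hE' _ _).1 ((hφ.arc a ha).2 hf)).resolve_left (hpos _)

/-- An arborescence is unavoidable for tournaments with at least as many vertices as the
arborescence has vertices and leaves together, minus one. Here all blocks are trivial. -/
theorem unavoidable_of_forall_fwd [Fintype V] {m : ℕ} (hf : ∀ a, a ≠ A.root → A.fwd a)
    (hm : Fintype.card V + #{a | ¬ A.HasFwdChild a} ≤ m + 1) : A.Unavoidable m := by
  have htop : ∀ a, A.IsTop a := fun a => (em (a = A.root)).imp_right (hf a)
  have hb : ∀ τ, A.block τ = {τ} := fun τ => by
    ext a
    rw [mem_block, top_of_isTop (htop a), mem_singleton]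
  refine unavoidable_of_blocks (g := fun _ => 1) (fun τ _ => by simp [hb]) ?_ ?_
  · intro τ _ E S _ hS
    obtain ⟨s, hs⟩ := card_pos.1 hS
    refine ⟨fun _ => s, by simp [hb], fun a ha => ⟨hs, fun h => absurd ?_ h⟩⟩
    simpa [hb] using ha
  · simpa [excess, hb] using hm

/-- The block with top `τ` as a rooted tree, with its arcs reversed: an arborescence. -/
noncomputable def blockTree [Fintype V] (A : RootedTree V) (τ : V) (hτ : A.IsTop τ) :
    RootedTree {a // a ∈ A.block τ} where
  root := ⟨τ, mem_block.2 (top_of_isTop hτ)⟩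
  par a := if h : a.1 = τ then a else ⟨A.par a.1, (par_mem_block a.2 h).2⟩
  rank a := A.rank a.1
  rank_par_lt a ha := by
    have h : a.1 ≠ τ := fun h => ha (Subtype.ext h)
    rw [dif_neg h]
    exact A.rank_par_lt _ fun h' => (par_mem_block a.2 h).1 (Or.inl h')
  fwd _ := True

lemma hasFwdChild_blockTree [Fintype V] {τ : V} (hτ : A.IsTop τ) (a : {a // a ∈ A.block τ}) :
    (A.blockTree τ hτ).HasFwdChild a ↔ A.HasBwdChild a.1 := by
  constructor
  · rintro ⟨c, hc, -, rfl⟩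
    have h : c.1 ≠ τ := fun h => hc (Subtype.ext h)
    have hnt := (par_mem_block c.2 h).1
    refine ⟨c.1, fun h' => hnt (Or.inl h'), fun h' => hnt (Or.inr h'), ?_⟩
    simp [blockTree, h]
  · rintro ⟨c, hc, hcf, hca⟩
    have hnt : ¬ A.IsTop c := fun h => h.elim hc hcf
    have hcb : c ∈ A.block τ := by
      rw [mem_block, top_of_not_isTop hnt, hca, ← mem_block]
      exact a.2
    have h : c ≠ τ := fun h => hnt (h ▸ hτ)
    refine ⟨⟨c, hcb⟩, fun h' => h (congrArg Subtype.val h'), trivial, Subtype.ext ?_⟩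
    simp [blockTree, h, hca]

lemma exists_mem_block_not_hasBwdChild [Fintype V] {τ : V} (hτ : A.IsTop τ) :
    0 < #{a ∈ A.block τ | ¬ A.HasBwdChild a} := by
  obtain ⟨w, hw, hmax⟩ := exists_max_image (A.block τ) A.rank
    ⟨τ, mem_block.2 (top_of_isTop hτ)⟩
  refine card_pos.2 ⟨w, mem_filter.2 ⟨hw, ?_⟩⟩
  rintro ⟨c, hc, hcf, rfl⟩
  have hnt : ¬ A.IsTop c := fun h => h.elim hc hcf
  have h1 := hmax c (by rw [mem_block, top_of_not_isTop hnt, ← mem_block]; exact hw)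
  have h2 := A.rank_par_lt c hc
  omega

/-- The bound obtained from the embedding procedure if every block, being a reversed arborescence,
is embedded by `unavoidable_of_forall_fwd`. -/
theorem unavoidable_of_tops [Fintype V] {m : ℕ}
    (hm : Fintype.card V + #{a | ¬ A.HasFwdChild a} + 2 * #{a | ¬ A.HasBwdChild a} ≤
      m + 1 + 2 * #{a | A.IsTop a}) : A.Unavoidable m := by
  set ℓ : V → ℕ := fun τ => #{a ∈ A.block τ | ¬ A.HasBwdChild a} with hℓ
  have hℓpos : ∀ τ, A.IsTop τ → 1 ≤ ℓ τ := fun τ hτ => exists_mem_block_not_hasBwdChild hτ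
  have hexc : A.excess (fun τ => #(A.block τ) + ℓ τ - 1) + #{a | A.IsTop a} =
      #{a | ¬ A.HasBwdChild a} := by
    rw [card_eq_sum_card_fiberwise (f := A.top) (s := {a | ¬ A.HasBwdChild a})
      (t := {a | A.IsTop a}) (fun a _ => by simpa using isTop_top a), excess, card_eq_sum_ones,
      ← sum_add_distrib]
    refine sum_congr rfl fun τ hτ => ?_
    have h1 := hℓpos τ (by simpa using hτ)
    have h2 : ℓ τ = #{a ∈ ({a | ¬ A.HasBwdChild a} : Finset V) | A.top a = τ} := by
      refine congrArg card (Finset.ext fun a => ?_)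
      simp [block, and_comm]
    omega
  refine unavoidable_of_blocks (g := fun τ => #(A.block τ) + ℓ τ - 1)
    (fun τ hτ => by have := hℓpos τ hτ; omega) ?_ (by omega)
  intro τ hτ E S hS hSc
  obtain ⟨φ, hφ⟩ := unavoidable_of_forall_fwd (A := A.blockTree τ hτ)
    (m := #(A.block τ) + ℓ τ - 1) (fun _ _ => trivial) (by
      have h1 : #({a | ¬ (A.blockTree τ hτ).HasFwdChild a} : Finset {a // a ∈ A.block τ}) =
          ℓ τ := by
        refine card_bij (fun a _ => a.1) ?_ (fun a _ b _ h => Subtype.ext h) ?_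
        · intro a ha
          simp only [mem_filter, mem_univ, true_and, hasFwdChild_blockTree] at ha
          exact mem_filter.2 ⟨a.2, ha⟩
        · intro b hb
          obtain ⟨hb1, hb2⟩ := mem_filter.1 hb
          exact ⟨⟨b, hb1⟩, by simpa [hasFwdChild_blockTree] using hb2, rfl⟩
      rw [h1, Fintype.card_coe]
      omega) (Function.swap E) S hS.swap hSc
  refine ⟨fun a => if h : a ∈ A.block τ then φ ⟨a, h⟩ else 0, ?_, ?_⟩
  · intro a ha b hb hab
    rw [mem_coe] at ha hb
    simp only [ha, hb, dif_pos] at hab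
    exact congrArg Subtype.val (hφ.inj hab)
  · intro a ha
    simp only [ha, dif_pos]
    refine ⟨hφ.mem _, fun haτ => ?_⟩
    have hp := (par_mem_block ha haτ).2
    have h := (hφ.arc ⟨a, ha⟩ fun h => haτ (congrArg Subtype.val h)).1 trivial
    simp only [blockTree, haτ, dite_false, Function.swap] at h
    simpa [hp] using h

/-- A rooted tree with `n` vertices, `k` of them childless, is unavoidable for tournaments with
about `3 (n + k) / 2` vertices: the bounds of `unavoidable_of_tops` for the tree and for its reverse
have this average. -/
theorem unavoidable_of_card_add_childless [Fintype V] {m : ℕ}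
    (hm : 3 * (Fintype.card V + #{a | ¬ A.HasChild a}) ≤ 2 * m + 5) : A.Unavoidable m := by
  by_contra hcon
  have h1 : ¬ (Fintype.card V + #{a | ¬ A.HasFwdChild a} + 2 * #{a | ¬ A.HasBwdChild a} ≤
      m + 1 + 2 * #{a | A.IsTop a}) := fun h => hcon (unavoidable_of_tops h)
  have hF : ∀ a, A.reverse.HasFwdChild a ↔ A.HasBwdChild a := fun a => Iff.rfl
  have hB : ∀ a, A.reverse.HasBwdChild a ↔ A.HasFwdChild a := fun a => by
    simp only [HasBwdChild, HasFwdChild, reverse, not_not]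
  have h2 : ¬ (Fintype.card V + #{a | ¬ A.HasBwdChild a} + 2 * #{a | ¬ A.HasFwdChild a} ≤
      m + 1 + 2 * #{a | A.reverse.IsTop a}) := fun h =>
    hcon (Unavoidable.of_reverse (unavoidable_of_tops (by simpa only [hF, hB] using h)))
  have h3 : #({a | A.IsTop a} : Finset V) + #({a | A.reverse.IsTop a} : Finset V) =
      Fintype.card V + 1 := by
    rw [← card_union_add_card_inter, ← card_univ]
    congr 1
    · congr 1
      ext a
      simp only [mem_union, mem_filter, mem_univ, true_and, iff_true]
      exact (em (A.fwd a)).imp Or.inr Or.inr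
    · rw [card_eq_one]
      refine ⟨A.root, ?_⟩
      ext a
      simp only [mem_inter, mem_filter, mem_univ, true_and, mem_singleton]
      exact ⟨fun ⟨h, h'⟩ => h.elim id fun h => h'.elim id fun h' => absurd h h',
        fun h => ⟨Or.inl h, Or.inl h⟩⟩
  have h4 : #({a | ¬ A.HasFwdChild a} : Finset V) + #({a | ¬ A.HasBwdChild a} : Finset V) ≤
      Fintype.card V + #({a | ¬ A.HasChild a} : Finset V) := by
    rw [← card_union_add_card_inter]
    refine add_le_add (card_le_univ _) (card_le_card fun a ha => ?_)
    simp only [mem_inter, mem_filter, mem_univ, true_and] at ha ⊢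
    rintro ⟨c, hc, hca⟩
    by_cases hf : A.fwd c
    · exact ha.1 ⟨c, hc, hf, hca⟩
    · exact ha.2 ⟨c, hc, hf, hca⟩
  omega

end RootedTree

/-! ### Placements of the inner tree and neighbourhoods of the childless vertices -/

namespace RootedTree

variable {V : Type*} {A : RootedTree V}

/-- A star centre: a vertex with children, all of which are childless. -/
def IsStarCentre (A : RootedTree V) (a : V) : Prop :=
  A.HasChild a ∧ ∀ c, c ≠ A.root → A.par c = a → ¬ A.HasChild c

/-- The rooted tree left after the deletion of all childless vertices. -/
noncomputable def inner (A : RootedTree V) (hr : A.HasChild A.root) :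
    RootedTree {a // A.HasChild a} where
  root := ⟨A.root, hr⟩
  par a := if h : a.1 = A.root then a else ⟨A.par a.1, a.1, h, rfl⟩
  rank a := A.rank a.1
  rank_par_lt a ha := by
    have h : a.1 ≠ A.root := fun h => ha (Subtype.ext h)
    rw [dif_neg h]
    exact A.rank_par_lt _ h
  fwd a := A.fwd a.1

/-- The childless vertices of the inner tree are the star centres. -/
lemma hasChild_inner (hr : A.HasChild A.root) (a : {a // A.HasChild a}) :
    (A.inner hr).HasChild a ↔ ¬ A.IsStarCentre a.1 := by
  have hiff : ∀ c : {a // A.HasChild a}, c.1 ≠ A.root →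
      ((A.inner hr).par c = a ↔ A.par c.1 = a.1) := fun c hc => by
    rw [Subtype.ext_iff]
    simp [inner, hc]
  constructor
  · rintro ⟨c, hc, hca⟩ hs
    have h : c.1 ≠ A.root := fun h => hc (Subtype.ext h)
    exact hs.2 c.1 h ((hiff c h).1 hca) c.2
  · intro h
    simp only [IsStarCentre, not_and, not_forall, not_not] at h
    obtain ⟨c, hc, hca, hcc⟩ := h a.2
    exact ⟨⟨c, hcc⟩, fun h => hc (congrArg Subtype.val h), (hiff ⟨c, hcc⟩ hc).2 hca⟩

variable (A) in
/-- The placement of the vertices with children at the positions given by `φ`, inside a window of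
`c` positions that is preceded by `R` positions and followed by `M - (R + c)` positions. The
majority conditions are those of a median order, for the final and the initial intervals only. -/
structure IsInnerPlacement (E : ℕ → ℕ → Prop) (φ : V → ℕ) (M R c : ℕ) : Prop where
  out_majority : ∀ p < M, M ≤ p + 1 + 2 * #{w ∈ Ico (p + 1) M | E p w}
  in_majority : ∀ q < M, q ≤ 2 * #{w ∈ range q | E w q}
  inj : Set.InjOn φ {a | A.HasChild a}
  mem : ∀ a, A.HasChild a → R ≤ φ a ∧ φ a < R + c
  le : R + c ≤ M

lemma IsInnerPlacement.card_le_sub {E : ℕ → ℕ → Prop} {φ : V → ℕ} {M R c : ℕ}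
    (hφ : A.IsInnerPlacement E φ M R c) {Z : Finset V} {i j : ℕ}
    (hZ : ∀ a ∈ Z, A.HasChild a ∧ i ≤ φ a ∧ φ a < j) : #Z ≤ j - i := by
  rw [← Nat.card_Ico]
  exact card_le_card_of_injOn φ (fun a ha => mem_coe.2 (mem_Ico.2 (hZ a ha).2))
    fun a ha b hb h => hφ.inj (hZ a ha).1 (hZ b hb).1 h

section Leaves

variable [Fintype V]

/-- If no leaf of `I` is attached to a vertex of `Y`, then the leaves of `K` attached to `Y` are
missing from `I`. -/
lemma two_mul_card_add_card_le {K I Y : Finset V} (hI : I ⊆ K) (hIY : ∀ ℓ ∈ I, A.par ℓ ∉ Y)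
    (hY : ∀ a ∈ Y, A.HasChild a) :
    2 * #I + #Y ≤ 2 * #K + #{a | A.HasChild a ∧ ¬ A.IsStarCentre a} +
      #{a | A.IsStarCentre a ∧ ∀ ℓ ∈ K, A.par ℓ ≠ a} := by
  have h1 : #{a ∈ Y | ∃ ℓ ∈ K, A.par ℓ = a} ≤ #(K \ I) := by
    refine card_le_card_of_surjOn A.par fun a ha => ?_
    simp only [coe_filter, Set.mem_ofPred_eq] at ha
    obtain ⟨haY, ℓ, hℓ, rfl⟩ := ha
    exact ⟨ℓ, mem_coe.2 (mem_sdiff.2 ⟨hℓ, fun h => hIY ℓ h haY⟩), rfl⟩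
  have h2 : #Y ≤ #{a | A.HasChild a ∧ ¬ A.IsStarCentre a} +
      #{a | A.IsStarCentre a ∧ ∀ ℓ ∈ K, A.par ℓ ≠ a} + #{a ∈ Y | ∃ ℓ ∈ K, A.par ℓ = a} := by
    refine (card_le_card fun a ha => ?_).trans
      ((card_union_le _ _).trans (Nat.add_le_add_right (card_union_le _ _) _))
    have := hY a ha
    simp only [mem_union, mem_filter, mem_univ, true_and]
    by_cases hs : A.IsStarCentre a
    · by_cases hℓ : ∃ ℓ ∈ K, A.par ℓ = a
      · exact Or.inr ⟨ha, hℓ⟩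
      · push Not at hℓ
        exact Or.inl (Or.inr ⟨hs, hℓ⟩)
    · exact Or.inl (Or.inl ⟨this, hs⟩)
  have h3 := card_sdiff_add_card_eq_card hI
  omega

variable (A) in
/-- The positions of the vertices with children. -/
noncomputable def usedPositions (φ : V → ℕ) : Finset ℕ :=
  ({a | A.HasChild a} : Finset V).image φ

variable (A) in
/-- The free in-neighbours before position `q`. -/
noncomputable def freeIn (E : ℕ → ℕ → Prop) (φ : V → ℕ) (q : ℕ) : Finset ℕ :=
  {w ∈ range q | E w q} \ A.usedPositions φ

variable (A) in
/-- The free out-neighbours after position `p`. -/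
noncomputable def freeOut (E : ℕ → ℕ → Prop) (φ : V → ℕ) (M p : ℕ) : Finset ℕ :=
  {w ∈ Ico (p + 1) M | E p w} \ A.usedPositions φ

namespace IsInnerPlacement

variable {E : ℕ → ℕ → Prop} {φ : V → ℕ} {M R c : ℕ}

/-- Hall's condition for in-leaves `I ⊆ K` attached at or after `q`: half of the positions before
`q` are in-neighbours of `q`, and each star centre before `q` has either no leaf in `K` or one in
`K \ I`, and is accounted for by the margin `R` in both cases. -/
lemma card_le_card_freeIn (hφ : A.IsInnerPlacement E φ M R c) {K I : Finset V} {q : ℕ}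
    (hR : 2 * #K + #{a | A.HasChild a ∧ ¬ A.IsStarCentre a} +
      #{a | A.IsStarCentre a ∧ ∀ ℓ ∈ K, A.par ℓ ≠ a} ≤ R)
    (hI : I ⊆ K) (hq : R ≤ q ∧ q < R + c) (hmin : ∀ ℓ ∈ I, q ≤ φ (A.par ℓ)) :
    #I ≤ #(A.freeIn E φ q) := by
  set Y : Finset V := {a | A.HasChild a ∧ φ a < q} with hY
  have h1 := two_mul_card_add_card_le (A := A) (Y := Y) hI
    (fun ℓ hℓ h => by
      have := hmin ℓ hℓ
      simp only [hY, mem_filter, mem_univ, true_and] at h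
      omega) (fun a ha => (by simpa [hY] using ha : _ ∧ _).1)
  have h2 : #Y ≤ q - R := hφ.card_le_sub fun a ha => by
    obtain ⟨-, ha, h⟩ := mem_filter.1 ha
    exact ⟨ha, (hφ.mem a ha).1, h⟩
  have h3 := hφ.in_majority q (by have := hφ.le; omega)
  have h4 : #{w ∈ range q | E w q} ≤ #(A.freeIn E φ q) + #Y := by
    have h : {w ∈ range q | E w q} ⊆ A.freeIn E φ q ∪ Y.image φ := by
      intro w hw
      by_cases hu : w ∈ A.usedPositions φ
      · obtain ⟨a, ha, rfl⟩ := mem_image.1 hu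
        simp only [mem_filter, mem_range, mem_univ, true_and] at ha hw
        exact mem_union_right _ (mem_image_of_mem _ (by simp [hY, ha, hw.1]))
      · exact mem_union_left _ (mem_sdiff.2 ⟨hw, hu⟩)
    exact (card_le_card h).trans ((card_union_le _ _).trans (by gcongr; exact card_image_le))
  omega

/-- Hall's condition for out-leaves attached at or before `p`, the mirror image of
`card_le_card_freeIn`. -/
lemma card_le_card_freeOut (hφ : A.IsInnerPlacement E φ M R c) {K O : Finset V} {p : ℕ}
    (hR : R + c + (2 * #K + #{a | A.HasChild a ∧ ¬ A.IsStarCentre a} +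
      #{a | A.IsStarCentre a ∧ ∀ ℓ ∈ K, A.par ℓ ≠ a}) ≤ M)
    (hO : O ⊆ K) (hp : R ≤ p ∧ p < R + c) (hmax : ∀ ℓ ∈ O, φ (A.par ℓ) ≤ p) :
    #O ≤ #(A.freeOut E φ M p) := by
  set Y : Finset V := {a | A.HasChild a ∧ p < φ a} with hY
  have h1 := two_mul_card_add_card_le (A := A) (Y := Y) hO
    (fun ℓ hℓ h => by
      have := hmax ℓ hℓ
      simp only [hY, mem_filter, mem_univ, true_and] at h
      omega) (fun a ha => (by simpa [hY] using ha : _ ∧ _).1)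
  have h2 : #Y ≤ R + c - (p + 1) := hφ.card_le_sub fun a ha => by
    obtain ⟨-, ha, h⟩ := mem_filter.1 ha
    exact ⟨ha, h, (hφ.mem a ha).2⟩
  have h3 := hφ.out_majority p (by have := hφ.le; omega)
  have h4 : #{w ∈ Ico (p + 1) M | E p w} ≤ #(A.freeOut E φ M p) + #Y := by
    have h : {w ∈ Ico (p + 1) M | E p w} ⊆ A.freeOut E φ M p ∪ Y.image φ := by
      intro w hw
      by_cases hu : w ∈ A.usedPositions φ
      · obtain ⟨a, ha, rfl⟩ := mem_image.1 hu
        simp only [mem_filter, mem_Ico, mem_univ, true_and] at ha hw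
        exact mem_union_right _ (mem_image_of_mem _ (by simp [hY, ha]; omega))
      · exact mem_union_left _ (mem_sdiff.2 ⟨hw, hu⟩)
    exact (card_le_card h).trans ((card_union_le _ _).trans (by gcongr; exact card_image_le))
  omega

/-- The crucial case of Hall's condition: the out-leaves `O` are attached at or before `p`, the
in-leaves `I` at or after `q`, and `p < q`. The two neighbourhoods may overlap between `p` and `q`,
but each star centre strictly between `p` and `q` has a leaf that is neither in `I` nor in `O`. -/
lemma card_add_card_le (hφ : A.IsInnerPlacement E φ M R c)
    (hM : 2 * #{a | ¬ A.HasChild a} + 2 * #{a | A.HasChild a} + c ≤ M + #{a | A.IsStarCentre a})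
    {I O : Finset V} (hI : ∀ ℓ ∈ I, ¬ A.HasChild ℓ) (hO : ∀ ℓ ∈ O, ¬ A.HasChild ℓ)
    {p q : ℕ} (hp : R ≤ p) (hpq : p < q) (hq : q < R + c)
    (hmin : ∀ ℓ ∈ I, q ≤ φ (A.par ℓ)) (hmax : ∀ ℓ ∈ O, φ (A.par ℓ) ≤ p) :
    #I + #O ≤ #(A.freeIn E φ q ∪ A.freeOut E φ M p) := by
  have hle := hφ.le
  set N₁ := {w ∈ range q | E w q} with hN₁
  set N₂ := {w ∈ Ico (p + 1) M | E p w} with hN₂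
  have h1 : q ≤ 2 * #N₁ := hφ.in_majority q (by omega)
  have h2 : M ≤ p + 1 + 2 * #N₂ := hφ.out_majority p (by omega)
  have h3 : #(N₁ ∪ N₂) + #(N₁ ∩ N₂) = #N₁ + #N₂ := card_union_add_card_inter _ _
  have h4 : #(N₁ ∩ N₂) ≤ q - (p + 1) := by
    rw [← Nat.card_Ico]
    refine card_le_card fun w hw => ?_
    simp only [hN₁, hN₂, mem_inter, mem_filter, mem_range, mem_Ico] at hw ⊢
    omega
  have h5 : #(N₁ ∪ N₂) ≤ #(A.freeIn E φ q ∪ A.freeOut E φ M p) + #{a | A.HasChild a} := by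
    have h : N₁ ∪ N₂ ⊆ (A.freeIn E φ q ∪ A.freeOut E φ M p) ∪ A.usedPositions φ := by
      intro w hw
      simp only [freeIn, freeOut, mem_union, mem_sdiff] at hw ⊢
      tauto
    exact (card_le_card h).trans ((card_union_le _ _).trans (by gcongr; exact card_image_le))
  -- The star centres strictly between the two positions, outside, and on the two positions.
  set Z₁ : Finset V := {a | A.IsStarCentre a ∧ p < φ a ∧ φ a < q} with hZ₁
  set Z₂ : Finset V := {a | A.HasChild a ∧ φ a < p} with hZ₂
  set Z₃ : Finset V := {a | A.HasChild a ∧ q < φ a} with hZ₃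
  set Z₄ : Finset V := {a | A.HasChild a ∧ φ a = p} with hZ₄
  set Z₅ : Finset V := {a | A.HasChild a ∧ φ a = q} with hZ₅
  have h6 : #{a | A.IsStarCentre a} ≤ #Z₁ + (#Z₂ + #Z₃ + (#Z₄ + #Z₅)) := by
    have h : ({a | A.IsStarCentre a} : Finset V) ⊆ Z₁ ∪ ((Z₂ ∪ Z₃) ∪ (Z₄ ∪ Z₅)) := by
      intro a ha
      simp only [hZ₁, hZ₂, hZ₃, hZ₄, hZ₅, mem_union, mem_filter, mem_univ, true_and] at ha ⊢
      have := ha.1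
      rcases lt_trichotomy (φ a) p with h | h | h
      · tauto
      · tauto
      · rcases lt_trichotomy (φ a) q with h' | h' | h' <;> tauto
    refine (card_le_card h).trans ((card_union_le _ _).trans ?_)
    gcongr
    refine (card_union_le _ _).trans ?_
    gcongr <;> exact card_union_le _ _
  have h7 : #Z₂ ≤ p - R := hφ.card_le_sub fun a ha => by
    obtain ⟨-, ha, h⟩ := mem_filter.1 ha
    exact ⟨ha, (hφ.mem a ha).1, h⟩
  have h8 : #Z₃ ≤ R + c - (q + 1) := hφ.card_le_sub fun a ha => by
    obtain ⟨-, ha, h⟩ := mem_filter.1 ha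
    exact ⟨ha, h, (hφ.mem a ha).2⟩
  have h9 : #Z₄ ≤ p + 1 - p := hφ.card_le_sub fun a ha => by
    obtain ⟨-, ha, h⟩ := mem_filter.1 ha
    exact ⟨ha, by omega⟩
  have h10 : #Z₅ ≤ q + 1 - q := hφ.card_le_sub fun a ha => by
    obtain ⟨-, ha, h⟩ := mem_filter.1 ha
    exact ⟨ha, by omega⟩
  have h11 : #I + #O + #Z₁ ≤ #{a | ¬ A.HasChild a} := by
    have hdisj : Disjoint I O := by
      rw [disjoint_left]
      intro ℓ h h'
      have := hmin ℓ h
      have := hmax ℓ h'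
      omega
    have hsub : I ∪ O ⊆ ({a | ¬ A.HasChild a} : Finset V) := by
      intro ℓ hℓ
      rcases mem_union.1 hℓ with h | h
      · simpa using hI ℓ h
      · simpa using hO ℓ h
    have h : #Z₁ ≤ #(({a | ¬ A.HasChild a} : Finset V) \ (I ∪ O)) := by
      refine card_le_card_of_surjOn A.par fun a ha => ?_
      simp only [hZ₁, coe_filter, mem_univ, true_and, Set.mem_ofPred_eq] at ha
      obtain ⟨⟨⟨ℓ, hℓ, hℓa⟩, hs⟩, hpa, haq⟩ := ha
      refine ⟨ℓ, mem_coe.2 (mem_sdiff.2 ⟨by simpa using hs ℓ hℓ hℓa, fun h => ?_⟩), hℓa⟩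
      subst hℓa
      rcases mem_union.1 h with h | h
      · have := hmin ℓ h; omega
      · have := hmax ℓ h; omega
    have := card_sdiff_add_card_eq_card hsub
    rw [card_union_of_disjoint hdisj] at this
    omega
  omega

end IsInnerPlacement

end Leaves

end RootedTree

/-! ### The bound for trees with many childless vertices -/

namespace RootedTree

variable {V : Type*} {A : RootedTree V}

lemma hasChild_par {ℓ : V} (hr : A.HasChild A.root) (hℓ : ¬ A.HasChild ℓ) :
    A.HasChild (A.par ℓ) :=
  ⟨ℓ, fun h => hℓ (h ▸ hr), rfl⟩

variable [Fintype V]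

/-- By Hall's theorem, the childless vertices can be added to the placement of the other vertices.
-/
lemma IsInnerPlacement.exists_leaves {E : ℕ → ℕ → Prop} {φ : V → ℕ} {M R c : ℕ}
    (hφ : A.IsInnerPlacement E φ M R c) (hr : A.HasChild A.root)
    (hM : 2 * #{a | ¬ A.HasChild a} + 2 * #{a | A.HasChild a} + c ≤ M + #{a | A.IsStarCentre a})
    {KI KO : Finset V} (hKI : ∀ ℓ, ¬ A.HasChild ℓ → ¬ A.fwd ℓ → ℓ ∈ KI)
    (hKO : ∀ ℓ, ¬ A.HasChild ℓ → A.fwd ℓ → ℓ ∈ KO)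
    (hI : 2 * #KI + #{a | A.HasChild a ∧ ¬ A.IsStarCentre a} +
      #{a | A.IsStarCentre a ∧ ∀ ℓ ∈ KI, A.par ℓ ≠ a} ≤ R)
    (hO : R + c + (2 * #KO + #{a | A.HasChild a ∧ ¬ A.IsStarCentre a} +
      #{a | A.IsStarCentre a ∧ ∀ ℓ ∈ KO, A.par ℓ ≠ a}) ≤ M) :
    ∃ f : V → ℕ, Set.InjOn f {ℓ | ¬ A.HasChild ℓ} ∧ ∀ ℓ, ¬ A.HasChild ℓ →
      (A.fwd ℓ → f ℓ ∈ A.freeOut E φ M (φ (A.par ℓ))) ∧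
      (¬ A.fwd ℓ → f ℓ ∈ A.freeIn E φ (φ (A.par ℓ))) := by
  set N : {ℓ // ¬ A.HasChild ℓ} → Finset ℕ := fun ℓ =>
    if A.fwd ℓ.1 then A.freeOut E φ M (φ (A.par ℓ.1)) else A.freeIn E φ (φ (A.par ℓ.1)) with hN
  have hall : ∀ T : Finset {ℓ // ¬ A.HasChild ℓ}, #T ≤ #(T.biUnion N) := by
    intro T
    set I : Finset V := {ℓ ∈ T.image Subtype.val | ¬ A.fwd ℓ} with hIdef
    set O : Finset V := {ℓ ∈ T.image Subtype.val | A.fwd ℓ} with hOdef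
    have hcard : #T = #I + #O := by
      rw [← card_image_of_injective T Subtype.val_injective,
        ← card_filter_add_card_filter_not (s := T.image Subtype.val) (fun ℓ => A.fwd ℓ), add_comm]
    have hIT : ∀ ℓ ∈ I, ∃ h : ¬ A.HasChild ℓ, (⟨ℓ, h⟩ : {ℓ // ¬ A.HasChild ℓ}) ∈ T ∧ ¬ A.fwd ℓ := by
      intro ℓ hℓ
      obtain ⟨h, hf⟩ := mem_filter.1 hℓ
      obtain ⟨⟨ℓ, hl⟩, hT, rfl⟩ := mem_image.1 h
      exact ⟨hl, hT, hf⟩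
    have hOT : ∀ ℓ ∈ O, ∃ h : ¬ A.HasChild ℓ, (⟨ℓ, h⟩ : {ℓ // ¬ A.HasChild ℓ}) ∈ T ∧ A.fwd ℓ := by
      intro ℓ hℓ
      obtain ⟨h, hf⟩ := mem_filter.1 hℓ
      obtain ⟨⟨ℓ, hl⟩, hT, rfl⟩ := mem_image.1 h
      exact ⟨hl, hT, hf⟩
    have hin : I = ∅ ∨ ∃ q, R ≤ q ∧ q < R + c ∧ (∀ ℓ ∈ I, q ≤ φ (A.par ℓ)) ∧
        #I ≤ #(A.freeIn E φ q) ∧ A.freeIn E φ q ⊆ T.biUnion N := by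
      refine I.eq_empty_or_nonempty.imp_right fun hne => ?_
      obtain ⟨ℓ, hℓ, hmin⟩ := exists_min_image I (fun ℓ => φ (A.par ℓ)) hne
      obtain ⟨hc, hT, hf⟩ := hIT ℓ hℓ
      have hq := hφ.mem _ (hasChild_par hr hc)
      refine ⟨_, hq.1, hq.2, hmin, hφ.card_le_card_freeIn hI
        (fun ℓ hℓ => hKI ℓ (hIT ℓ hℓ).1 (hIT ℓ hℓ).2.2) hq hmin, ?_⟩
      have := subset_biUnion_of_mem N hT
      simpa only [hN, hf, if_false] using this
    have hout : O = ∅ ∨ ∃ p, R ≤ p ∧ p < R + c ∧ (∀ ℓ ∈ O, φ (A.par ℓ) ≤ p) ∧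
        #O ≤ #(A.freeOut E φ M p) ∧ A.freeOut E φ M p ⊆ T.biUnion N := by
      refine O.eq_empty_or_nonempty.imp_right fun hne => ?_
      obtain ⟨ℓ, hℓ, hmax⟩ := exists_max_image O (fun ℓ => φ (A.par ℓ)) hne
      obtain ⟨hc, hT, hf⟩ := hOT ℓ hℓ
      have hp := hφ.mem _ (hasChild_par hr hc)
      refine ⟨_, hp.1, hp.2, hmax, hφ.card_le_card_freeOut hO
        (fun ℓ hℓ => hKO ℓ (hOT ℓ hℓ).1 (hOT ℓ hℓ).2.2) hp hmax, ?_⟩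
      have := subset_biUnion_of_mem N hT
      simpa only [hN, hf, if_true] using this
    rw [hcard]
    rcases hin with hI0 | ⟨q, hRq, hqc, hmin, hIq, hsubq⟩
    · rcases hout with hO0 | ⟨p, -, -, -, hOp, hsubp⟩
      · simp [hI0, hO0]
      · rw [hI0, card_empty, zero_add]
        exact hOp.trans (card_le_card hsubp)
    · rcases hout with hO0 | ⟨p, hRp, hpc, hmax, hOp, hsubp⟩
      · rw [hO0, card_empty, add_zero]
        exact hIq.trans (card_le_card hsubq)
      · have hsub := union_subset hsubq hsubp
        rcases lt_or_ge p q with hpq | hpq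
        · exact (hφ.card_add_card_le hM (fun ℓ hℓ => (hIT ℓ hℓ).1) (fun ℓ hℓ => (hOT ℓ hℓ).1)
            hRp hpq hqc hmin hmax).trans (card_le_card hsub)
        · have hdisj : Disjoint (A.freeIn E φ q) (A.freeOut E φ M p) := by
            rw [disjoint_left]
            intro w hw hw'
            simp only [freeIn, freeOut, mem_sdiff, mem_filter, mem_range, mem_Ico] at hw hw'
            omega
          have := card_le_card hsub
          rw [card_union_of_disjoint hdisj] at this
          omega
  obtain ⟨f, hf, hfN⟩ := (all_card_le_biUnion_card_iff_exists_injective N).1 hall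
  refine ⟨fun ℓ => if h : ¬ A.HasChild ℓ then f ⟨ℓ, h⟩ else 0, ?_, ?_⟩
  · intro a (ha : ¬ _) b (hb : ¬ _) hab
    simp only [ha, hb, not_false_eq_true, dif_pos] at hab
    exact congrArg Subtype.val (hf hab)
  · intro ℓ hℓ
    have := hfN ⟨ℓ, hℓ⟩
    simp only [hN] at this
    refine ⟨fun h => ?_, fun h => ?_⟩ <;>
      simpa only [hℓ, not_false_eq_true, dif_pos, h, if_true, if_false] using this

/-- A bound for rooted trees with many childless vertices: a tree without its childless vertices is
embedded in the middle of a median order, and the childless vertices are added by Hall's theorem.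
-/
theorem unavoidable_of_inner {c m : ℕ} (hr : A.HasChild A.root) (hc : (A.inner hr).Unavoidable c)
    (hm : 2 * #{a | ¬ A.HasChild a} + 2 * #{a | A.HasChild a} + c ≤
      m + #{a | A.IsStarCentre a}) : A.Unavoidable m := by
  intro E S hS hmS
  obtain ⟨e, hinj, hmem, hfwd, hbwd⟩ := exists_median_order E S hS
  have hinj' : ∀ i < #S, ∀ j < #S, e i = e j → i = j := fun i hi j hj h => hinj hi hj h
  obtain ⟨E', hE'⟩ : ∃ E' : ℕ → ℕ → Prop, ∀ i j, E' i j ↔ E (e i) (e j) :=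
    ⟨_, fun _ _ => Iff.rfl⟩
  set KI : Finset V := {ℓ | ¬ A.HasChild ℓ ∧ ¬ A.fwd ℓ} with hKI
  set KO : Finset V := {ℓ | ¬ A.HasChild ℓ ∧ A.fwd ℓ} with hKO
  -- The size of the left margin is the one that Hall's condition for the in-leaves requires.
  set R := 2 * #KI + #{a | A.HasChild a ∧ ¬ A.IsStarCentre a} +
      #{a | A.IsStarCentre a ∧ ∀ ℓ ∈ KI, A.par ℓ ≠ a} with hR
  have hK : #KI + #KO = #{a | ¬ A.HasChild a} := by
    rw [← card_union_of_disjoint]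
    · congr 1
      ext a
      simp only [hKI, hKO, mem_union, mem_filter, mem_univ, true_and]
      tauto
    · rw [disjoint_left]
      intro a h h'
      exact (mem_filter.1 h).2.2 (mem_filter.1 h').2.2
  have hx : #{a | A.HasChild a ∧ ¬ A.IsStarCentre a} + #{a | A.IsStarCentre a} =
      #{a | A.HasChild a} := by
    rw [← card_union_of_disjoint]
    · congr 1
      ext a
      simp only [mem_union, mem_filter, mem_univ, true_and]
      have : A.IsStarCentre a → A.HasChild a := fun h => h.1
      tauto
    · rw [disjoint_left]
      intro a h h'
      exact (mem_filter.1 h).2.2 (mem_filter.1 h').2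
  have hz : #{a | A.IsStarCentre a ∧ ∀ ℓ ∈ KI, A.par ℓ ≠ a} +
      #{a | A.IsStarCentre a ∧ ∀ ℓ ∈ KO, A.par ℓ ≠ a} ≤ #{a | A.IsStarCentre a} := by
    rw [← card_union_of_disjoint]
    · refine card_le_card fun a ha => ?_
      simp only [mem_union, mem_filter, mem_univ, true_and] at ha ⊢
      exact ha.elim And.left And.left
    · rw [disjoint_left]
      intro a h h'
      simp only [mem_filter, mem_univ, true_and] at h h'
      obtain ⟨⟨ℓ, hℓ, hℓa⟩, hs⟩ := h.1
      have hℓc := hs ℓ hℓ hℓa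
      by_cases hf : A.fwd ℓ
      · exact h'.2 ℓ (by simp [hKO, hℓc, hf]) hℓa
      · exact h.2 ℓ (by simp [hKI, hℓc, hf]) hℓa
  have hRc : R + c + (2 * #KO + #{a | A.HasChild a ∧ ¬ A.IsStarCentre a} +
      #{a | A.IsStarCentre a ∧ ∀ ℓ ∈ KO, A.par ℓ ≠ a}) ≤ #S := by omega
  clear_value R
  -- The inner tree is placed in a window that leaves enough positions on both sides.
  have himg : #((Ico R (R + c)).image e) = c := by
    rw [card_image_of_injOn, Nat.card_Ico, Nat.add_sub_cancel_left]
    intro i hi j hj h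
    rw [mem_coe, mem_Ico] at hi hj
    exact hinj' i (by omega) j (by omega) h
  have hsub : (Ico R (R + c)).image e ⊆ S := by
    intro w hw
    obtain ⟨i, hi, rfl⟩ := mem_image.1 hw
    rw [mem_Ico] at hi
    exact hmem i (by omega)
  obtain ⟨ψ, hψ⟩ := hc E _ (hS.mono hsub) himg.ge
  have hex : ∀ a, ∃ i, ∀ h : A.HasChild a, (R ≤ i ∧ i < R + c) ∧ e i = ψ ⟨a, h⟩ := by
    intro a
    by_cases ha : A.HasChild a
    · obtain ⟨i, hi, h⟩ := mem_image.1 (hψ.mem ⟨a, ha⟩)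
      exact ⟨i, fun _ => ⟨mem_Ico.1 hi, h⟩⟩
    · exact ⟨0, fun h => absurd h ha⟩
  choose φ hφ using hex
  have hpl : A.IsInnerPlacement E' φ #S R c := by
    refine ⟨fun p hp => ?_, fun q hq => ?_, fun a ha b hb h => ?_, fun a ha => (hφ a ha).1,
      by omega⟩
    · have h1 := hfwd p #S hp le_rfl
      have h2 := card_filter_add_card_filter_not (s := Ico (p + 1) #S) (fun w => E (e p) (e w))
      rw [Nat.card_Ico] at h2
      rw [filter_congr fun w _ => hE' p w]
      omega
    · have h1 := hbwd 0 q (Nat.zero_le _) hq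
      have h2 := card_filter_add_card_filter_not (s := Ico 0 q) (fun w => E (e w) (e q))
      rw [Nat.card_Ico] at h2
      rw [filter_congr fun w _ => hE' w q, range_eq_Ico]
      omega
    · have := hψ.inj (((hφ a ha).2.symm.trans (congrArg e h)).trans (hφ b hb).2)
      exact congrArg Subtype.val this
  obtain ⟨f, hfi, hf⟩ := hpl.exists_leaves hr (by omega) (KI := KI) (KO := KO)
    (fun ℓ h h' => by simp [hKI, h, h']) (fun ℓ h h' => by simp [hKO, h, h']) hR.ge hRc
  have hfS : ∀ ℓ, ¬ A.HasChild ℓ → f ℓ < #S ∧ f ℓ ∉ A.usedPositions φ := by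
    intro ℓ hℓ
    have hp := (hφ _ (hasChild_par hr hℓ)).1
    by_cases h : A.fwd ℓ
    · have := (hf ℓ hℓ).1 h
      simp only [freeOut, mem_sdiff, mem_filter, mem_Ico] at this
      exact ⟨by omega, this.2⟩
    · have := (hf ℓ hℓ).2 h
      simp only [freeIn, mem_sdiff, mem_filter, mem_range] at this
      exact ⟨by omega, this.2⟩
  set χ : V → ℕ := fun a => if A.HasChild a then φ a else f a with hχ
  have hχ1 : ∀ a, A.HasChild a → χ a = φ a := fun a h => if_pos h
  have hχ2 : ∀ a, ¬ A.HasChild a → χ a = f a := fun a h => if_neg h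
  have hχS : ∀ a, χ a < #S := by
    intro a
    by_cases h : A.HasChild a
    · have := (hφ a h).1
      rw [hχ1 a h]
      omega
    · rw [hχ2 a h]
      exact (hfS a h).1
  have hused : ∀ a, A.HasChild a → ∀ b, ¬ A.HasChild b → φ a ≠ f b := fun a ha b hb h =>
    (hfS b hb).2 (h ▸ mem_image_of_mem φ (by simpa using ha))
  have hχi : Function.Injective χ := by
    intro a b h
    by_cases ha : A.HasChild a <;> by_cases hb : A.HasChild b
    · rw [hχ1 a ha, hχ1 b hb] at h
      exact hpl.inj ha hb h
    · rw [hχ1 a ha, hχ2 b hb] at h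
      exact absurd h (hused a ha b hb)
    · rw [hχ2 a ha, hχ1 b hb] at h
      exact absurd h.symm (hused b hb a ha)
    · rw [hχ2 a ha, hχ2 b hb] at h
      exact hfi ha hb h
  refine ⟨fun a => e (χ a), fun a b h => hχi (hinj' _ (hχS a) _ (hχS b) h),
    fun a => hmem _ (hχS a), fun a ha => ?_⟩
  have hpc : A.HasChild (A.par a) := ⟨a, ha, rfl⟩
  by_cases hac : A.HasChild a
  · have h1 := hψ.arc ⟨a, hac⟩ fun h => ha (congrArg Subtype.val h)
    have h2 : (A.inner hr).par ⟨a, hac⟩ = ⟨A.par a, hpc⟩ := by simp [inner, ha]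
    simp only [RespectsArc, h2, ← (hφ _ hac).2, ← (hφ _ hpc).2] at h1
    simp only [RespectsArc, hχ1 a hac, hχ1 _ hpc]
    exact h1
  · simp only [RespectsArc, hχ2 a hac, hχ1 _ hpc]
    refine ⟨fun h => ?_, fun h => ?_⟩
    · have := (hf a hac).1 h
      simp only [freeOut, mem_sdiff, mem_filter] at this
      exact (hE' _ _).1 this.1.2
    · have := (hf a hac).2 h
      simp only [freeIn, mem_sdiff, mem_filter] at this
      exact (hE' _ _).1 this.1.2

end RootedTree

/-! ### Oriented trees -/

namespace RootedTree

variable {V : Type*} {A : RootedTree V}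

lemma hasChild_root [Fintype V] (h : 2 ≤ Fintype.card V) : A.HasChild A.root := by
  obtain ⟨b, hb⟩ := Fintype.exists_ne_of_one_lt_card (by omega) A.root
  obtain ⟨a, ha, hmin⟩ := exists_min_image ({a | a ≠ A.root} : Finset V) A.rank
    ⟨b, by simpa using hb⟩
  rw [mem_filter] at ha
  refine ⟨a, ha.2, ?_⟩
  by_contra hp
  have h1 := hmin (A.par a) (by simpa using hp)
  have h2 := A.rank_par_lt a ha.2
  omega

/-- A rooted tree with `n ≥ 2` vertices is unavoidable for tournaments with at least
`(42 n - 47) / 16` vertices: one of the two bounds applies. -/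
theorem unavoidable_of_card [Fintype V] {m : ℕ} (hV : 2 ≤ Fintype.card V)
    (hm : 42 * Fintype.card V ≤ 16 * m + 47) : A.Unavoidable m := by
  have hr : A.HasChild A.root := hasChild_root hV
  by_cases h1 : 3 * (Fintype.card V + #{a | ¬ A.HasChild a}) ≤ 2 * m + 5
  · exact unavoidable_of_card_add_childless h1
  have hn : #{a | A.HasChild a} + #{a | ¬ A.HasChild a} = Fintype.card V := by
    rw [card_filter_add_card_filter_not, card_univ]
  have hx : Fintype.card {a // A.HasChild a} = #{a | A.HasChild a} := Fintype.card_subtype _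
  have hx0 : 0 < #{a | A.HasChild a} := card_pos.2 ⟨A.root, by simpa using hr⟩
  have hzx : #{a | A.IsStarCentre a} ≤ #{a | A.HasChild a} :=
    card_le_card fun a ha => by simpa using (mem_filter.1 ha).2.1
  -- With at least two inner vertices, the root has an inner child, so it is not a star centre.
  have hz : 2 ≤ #{a | A.HasChild a} → #{a | A.IsStarCentre a} < #{a | A.HasChild a} := by
    intro h2
    have hroot := (hasChild_inner hr _).1 (hasChild_root (A := A.inner hr) (by omega))
    refine card_lt_card ((ssubset_iff_of_subset fun a ha => ?_).2
      ⟨A.root, by simpa using hr, fun h => hroot (mem_filter.1 h).2⟩)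
    simpa using (mem_filter.1 ha).2.1
  have hzi : #({a | ¬ (A.inner hr).HasChild a} : Finset {a // A.HasChild a}) =
      #{a | A.IsStarCentre a} := by
    refine card_bij (fun a _ => a.1) ?_ (fun a _ b _ h => Subtype.ext h) ?_
    · intro a ha
      simpa [hasChild_inner] using ha
    · intro b hb
      have hb := (mem_filter.1 hb).2
      exact ⟨⟨b, hb.1⟩, by simpa [hasChild_inner] using hb, rfl⟩
  -- The value of `c` is the least that the first bound gives for the inner tree.
  refine unavoidable_of_inner (c := (3 * (#{a | A.HasChild a} + #{a | A.IsStarCentre a}) - 4) / 2)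
    hr (unavoidable_of_card_add_childless ?_) ?_
  · rw [hx, hzi]
    omega
  · omega

end RootedTree

/-- An oriented tree as a rooted tree: the root is arbitrary, and the rank is the distance from the
root. A tree has no edges besides those between the vertices and their parents, as there are as many
of these as a tree has edges. -/
lemma exists_rootedTree {V : Type*} [Fintype V] {A : Digraph V} (hA : A.IsOrientedTree) :
    ∃ B : RootedTree V, ∀ x y, A.Adj x y →
      (y ≠ B.root ∧ B.par y = x ∧ B.fwd y) ∨ (x ≠ B.root ∧ B.par x = y ∧ ¬ B.fwd x) := by
  obtain ⟨G, hG, hGA, hasymm⟩ := hA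
  obtain ⟨r⟩ := hG.1.nonempty
  have hex : ∀ a, ∃ b, a ≠ r → G.Adj a b ∧ G.dist b r < G.dist a r := by
    intro a
    obtain ⟨p, hp⟩ := hG.1.exists_walk_length_eq_dist a r
    cases p with
    | nil => exact ⟨r, fun h => absurd rfl h⟩
    | cons h q =>
      refine ⟨_, fun _ => ⟨h, ?_⟩⟩
      have := G.dist_le q
      rw [SimpleGraph.Walk.length_cons] at hp
      omega
  choose par hpar using hex
  have hinj : Set.InjOn (fun a => s(a, par a)) {a | a ≠ r} := by
    intro a ha b hb hab
    rcases Sym2.eq_iff.1 hab with h | ⟨h1, h2⟩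
    · exact h.1
    · have ha' := (hpar a ha).2
      have hb' := (hpar b hb).2
      rw [h2] at ha'
      rw [← h1] at hb'
      omega
  have himg : ({a | a ≠ r} : Finset V).image (fun a => s(a, par a)) = G.edgeFinset := by
    refine eq_of_subset_of_card_le (fun e he => ?_) ?_
    · obtain ⟨a, ha, rfl⟩ := mem_image.1 he
      exact SimpleGraph.mem_edgeFinset.2 (hpar a (mem_filter.1 ha).2).1
    · have h1 := hG.card_edgeFinset
      rw [card_image_of_injOn (by simpa using hinj), filter_ne', card_erase_of_mem (mem_univ _),
        card_univ]
      omega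
  have hedge : ∀ x y, G.Adj x y → (y ≠ r ∧ par y = x) ∨ (x ≠ r ∧ par x = y) := by
    intro x y h
    have he := SimpleGraph.mem_edgeFinset.2 ((SimpleGraph.mem_edgeSet G).2 h)
    rw [← himg] at he
    obtain ⟨a, ha, hae⟩ := mem_image.1 he
    have ha := (mem_filter.1 ha).2
    rcases Sym2.eq_iff.1 hae with ⟨rfl, hp⟩ | ⟨rfl, hp⟩
    · exact Or.inr ⟨ha, hp⟩
    · exact Or.inl ⟨ha, hp⟩
  refine ⟨⟨r, par, fun a => G.dist a r, fun a ha => (hpar a ha).2, fun a => A.Adj (par a) a⟩,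
    fun x y h => ?_⟩
  rcases hedge x y ((hGA x y).2 (Or.inl h)) with ⟨h1, rfl⟩ | ⟨h1, rfl⟩
  · exact Or.inl ⟨h1, rfl, h⟩
  · exact Or.inr ⟨h1, rfl, hasymm _ _ h⟩

lemma RootedTree.Unavoidable.isUnavoidable {V : Type u} {A : Digraph V} {B : RootedTree V} {m : ℕ}
    (hB : B.Unavoidable m) (hAB : ∀ x y, A.Adj x y →
      (y ≠ B.root ∧ B.par y = x ∧ B.fwd y) ∨ (x ≠ B.root ∧ B.par x = y ∧ ¬ B.fwd x)) :
    Digraph.IsUnavoidable.{u, v} A m := by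
  intro W _ hW T hT
  have ε : W ≃ Fin m := Fintype.equivFinOfCardEq hW
  -- The tournament is transported to the numbers below `m`.
  obtain ⟨φ, hφ⟩ := hB
    (fun i j => ∃ (hi : i < m) (hj : j < m), T.Adj (ε.symm ⟨i, hi⟩) (ε.symm ⟨j, hj⟩)) (range m) (by
      intro i hi j hj hij
      rw [mem_range] at hi hj
      have hne : ε.symm ⟨i, hi⟩ ≠ ε.symm ⟨j, hj⟩ := by simpa using hij
      simp only [hi, hj, exists_true_left]
      exact ⟨hT.2 _ _, ((hT.1 _ _).1 hne).resolve_right⟩) (by simp)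
  refine ⟨fun a => ε.symm ⟨φ a, mem_range.1 (hφ.mem a)⟩, fun a b h => hφ.inj ?_, fun x y h => ?_⟩
  · simpa using h
  · rcases hAB x y h with ⟨h1, rfl, hf⟩ | ⟨h1, rfl, hf⟩
    · exact ((hφ.arc y h1).1 hf).2.2
    · exact ((hφ.arc x h1).2 hf).2.2

end OrientedTrees

theorem mainTheorem4 {V : Type u} [Fintype V] (n : ℕ) (hn : 2 ≤ n)
    (hcard : Fintype.card V = n) (A : Digraph V) (hA : A.IsOrientedTree) :
    Digraph.IsUnavoidable.{u, v} A ⌈(21 / 8 : ℝ) * (n : ℝ) - 47 / 16⌉₊ := by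
  obtain ⟨B, hB⟩ := OrientedTrees.exists_rootedTree hA
  refine (OrientedTrees.RootedTree.unavoidable_of_card (hcard ▸ hn) ?_).isUnavoidable hB
  have h := Nat.le_ceil ((21 / 8 : ℝ) * (n : ℝ) - 47 / 16)
  rw [hcard]
  have h' : (42 : ℝ) * n ≤ 16 * ⌈(21 / 8 : ℝ) * (n : ℝ) - 47 / 16⌉₊ + 47 := by linarith
  exact_mod_cast h'
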